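/- Let $n\ge 2$. A Gelfand--Tsetlin tableau of height $n$ is a vector $L=(l_{ij})_{1\le j\le i\le n}$ of complex numbers, written $T(L)$. Let $T(L)$ be generic, i.e. $l_{ki}-l_{kj}\notin\mathbb Z$ for all $1\le i\ne j\le k\le n-1$. Let $\mathcal B(T(L))$ be the set of all tableaux $T(L+z)$, where $z$ is a vector of integers with $z_{n1}=\dots=z_{nn}=0$, and let $V(T(L))$ be the complex vector space with basis $\mathcal B(T(L))$. It is a $\mathfrak{gl}(n)$-module through the Gelfand--Tsetlin formulas: for $T(R)\in\mathcal B(T(L))$, $R=(r_{ij})$, $$E_{k,k+1}T(R)=-\sum_{i=1}^{k}\frac{\prod_{j=1}^{k+1}(r_{ki}-r_{k+1,j})}{\prod_{j\ne i}(r_{ki}-r_{kj})}\,T(R+\delta^{ki}),\qquad E_{k+1,k}T(R)=\sum_{i=1}^{k}\frac{\prod_{j=1}^{k-1}(r_{ki}-r_{k-1,j})}{\prod_{j\ne i}(r_{ki}-r_{kj})}\,T(R-\delta^{ki})\qquad(1\le k\le n-1),$$ $$E_{kk}T(R)=\Big(k-1+\sum_{i=1}^{k}r_{ki}-\sum_{i=1}^{k-1}r_{k-1,i}\Big)T(R)\qquad(1\le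 k\le n),$$ where the products in the denominators run over $1\le j\le k$ with $j\ne i$, and $\delta^{ki}$ has $(k,i)$ entry $1$ and all other entries $0$. Write $U\cdot T(R)$ for the $\mathfrak{gl}(n)$-submodule of $V(T(L))$ generated by $T(R)$, and $$\Omega^+(T(R))=\{(p,s,u): 1<p\le n,\ 1\le s\le p,\ 1\le u\le p-1,\ r_{p,s}-r_{p-1,u}\in\mathbb Z_{\ge0}\}.$$ Then for all $T(R),T(Q)\in\mathcal B(T(L))$: $U\cdot T(R)=U\cdot T(Q)$ if and only if $\Omega^+(T(Q))=\Omega^+(T(R))$; more strongly, $U\cdot T(R)\subseteq U\cdot T(Q)$ if and only if $\Omega^+(T(Q))\subseteq\Omega^+(T(R))$. -/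

import Mathlib

set_option linter.unusedSectionVars false
set_option linter.unusedSimpArgs false
set_option linter.unusedVariables false

namespace GelfandTsetlin

open Finset

attribute [local instance] LieRing.ofAssociativeRing

/-! ### Gelfand--Tsetlin tableaux -/

/-- Positions `(i, j)`, `1 ≤ j ≤ i ≤ n`, of a tableau of height `n`: row `i`, place `j`. -/
abbrev Pos (n : ℕ) := {p : ℕ × ℕ // 1 ≤ p.2 ∧ p.2 ≤ p.1 ∧ p.1 ≤ n}

/-- A Gelfand--Tsetlin tableau `T(L)` of height `n`, that is, a vector `L = (l_{ij})` with
`n(n+1)/2` complex coordinates. -/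
abbrev Tableau (n : ℕ) := Pos n → ℂ

section Tableaux

variable {n : ℕ}

/-- The entry `r_{ij}` of `T(R)`; by convention it is `0` for indices outside the tableau, which
are never used. -/
def entry (R : Tableau n) (i j : ℕ) : ℂ :=
  if h : 1 ≤ j ∧ j ≤ i ∧ i ≤ n then R ⟨(i, j), h⟩ else 0

/-- `T(L)` is generic: `l_{ki} - l_{kj} ∉ ℤ` for all `1 ≤ i ≠ j ≤ k ≤ n - 1`. -/
def IsGeneric (L : Tableau n) : Prop :=
  ∀ k i j, 1 ≤ i → i ≤ k → 1 ≤ j → j ≤ k → k < n → i ≠ j →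
    ∀ m : ℤ, entry L k i - entry L k j ≠ m

/-- The set `B(T(L))` of the tableaux `T(L + z)`, where `z` is an integral vector with zero top
row. -/
def lattice (L : Tableau n) : Set (Tableau n) :=
  {R | ∃ z : Pos n → ℤ, (∀ p, p.1.1 = n → z p = 0) ∧ ∀ p, R p = L p + z p}

/-- `Ω⁺(T(R))`: the triples `(p, s, u)` with `1 < p ≤ n`, `1 ≤ s ≤ p`, `1 ≤ u ≤ p - 1` such that
`r_{p,s} - r_{p-1,u}` is a nonnegative integer. -/
def OmegaPlus (R : Tableau n) : Set (ℕ × ℕ × ℕ) :=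
  {t | (1 < t.1 ∧ t.1 ≤ n) ∧ (1 ≤ t.2.1 ∧ t.2.1 ≤ t.1) ∧ (1 ≤ t.2.2 ∧ t.2.2 ≤ t.1 - 1) ∧
    ∃ m : ℕ, entry R t.1 t.2.1 - entry R (t.1 - 1) t.2.2 = m}

/-- The tableau `T(R + s δ^{ki})`. It is only used for `1 ≤ i ≤ k < n`. -/
def move {L : Tableau n} (R : lattice L) (k i : ℕ) (s : ℤ) : lattice L :=
  if hk : k < n then
    ⟨fun p => R.1 p + if p.1 = (k, i) then (s : ℂ) else 0, by
      obtain ⟨z, hz, hR⟩ := R.2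
      refine ⟨fun p => z p + if p.1 = (k, i) then s else 0, fun p hp => ?_, fun p => ?_⟩
      · have : p.1 ≠ (k, i) := by rintro h; rw [h] at hp; exact hk.ne hp
        simp [hz p hp, this]
      · simp [hR p, add_assoc]⟩
  else R

end Tableaux

/-! ### The operators of the Gelfand--Tsetlin formulas -/

noncomputable section Operators

variable {n : ℕ}

/-- The quotient `∏_{j=1}^{r} (r_{ki} - r_{rj}) / ∏_{j ≠ i} (r_{ki} - r_{kj})`, for a row `r` next
to the row `k`. -/
def stepCoeff (R : Tableau n) (k r i : ℕ) : ℂ :=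
  (∏ j ∈ Icc 1 r, (entry R k i - entry R r j)) /
    ∏ j ∈ (Icc 1 k).erase i, (entry R k i - entry R k j)

/-- The operator `T(R) ↦ ∑_{i=1}^{k} stepCoeff R k r i • T(R + s δ^{ki})`. -/
def stepOp (L : Tableau n) (k r : ℕ) (s : ℤ) : Module.End ℂ (lattice L →₀ ℂ) :=
  Finsupp.linearCombination ℂ fun R =>
    ∑ i ∈ Icc 1 k, stepCoeff R.1 k r i • Finsupp.single (move R k i s) (1 : ℂ)

/-- The action of `E_{k,k+1}`. -/
def gtRaise (L : Tableau n) (k : ℕ) : Module.End ℂ (lattice L →₀ ℂ) := - stepOp L k (k + 1) 1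

/-- The action of `E_{k+1,k}`. -/
def gtLower (L : Tableau n) (k : ℕ) : Module.End ℂ (lattice L →₀ ℂ) := stepOp L k (k - 1) (-1)

/-- The eigenvalue `k - 1 + ∑_{i=1}^{k} r_{ki} - ∑_{i=1}^{k-1} r_{k-1,i}` of `E_{kk}`. -/
def diagCoeff (R : Tableau n) (k : ℕ) : ℂ :=
  (k : ℂ) - 1 + ∑ i ∈ Icc 1 k, entry R k i - ∑ i ∈ Icc 1 (k - 1), entry R (k - 1) i

/-- The action of `E_{kk}`. -/
def gtDiag (L : Tableau n) (k : ℕ) : Module.End ℂ (lattice L →₀ ℂ) :=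
  Finsupp.linearCombination ℂ fun R => diagCoeff R.1 k • Finsupp.single R (1 : ℂ)

end Operators

/-! ### Lie algebra homomorphisms out of `gl(n)` from elements that satisfy the defining relations -/

section Abstract
variable {A : Type*} [LieRing A] [LieAlgebra ℂ A]

/-- Relations among elements `h i` (`i < n`), `e k`, `f k` (`k + 1 < n`) of a Lie algebra: the
Chevalley--Serre relations of `gl(n)`. -/
structure GlRel (n : ℕ) (h e f : ℕ → A) : Prop where
  hh : ∀ i j, i < n → j < n → ⁅h i, h j⁆ = 0
  he : ∀ i k, i < n → k + 1 < n →
    ⁅h i, e k⁆ = ((if i = k then (1 : ℂ) else 0) - (if i = k + 1 then 1 else 0)) • e k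
  hf : ∀ i k, i < n → k + 1 < n →
    ⁅h i, f k⁆ = ((if i = k + 1 then (1 : ℂ) else 0) - (if i = k then 1 else 0)) • f k
  ef : ∀ k, k + 1 < n → ⁅e k, f k⁆ = h k - h (k + 1)
  ef' : ∀ k l, k + 1 < n → l + 1 < n → k ≠ l → ⁅e k, f l⁆ = 0
  ee : ∀ k l, l + 1 < n → k + 1 < l → ⁅e k, e l⁆ = 0
  ff : ∀ k l, l + 1 < n → k + 1 < l → ⁅f k, f l⁆ = 0
  se : ∀ k, k + 2 < n → ⁅e k, ⁅e k, e (k + 1)⁆⁆ = 0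
  se' : ∀ k, k + 2 < n → ⁅e (k + 1), ⁅e (k + 1), e k⁆⁆ = 0
  sf : ∀ k, k + 2 < n → ⁅f k, ⁅f k, f (k + 1)⁆⁆ = 0
  sf' : ∀ k, k + 2 < n → ⁅f (k + 1), ⁅f (k + 1), f k⁆⁆ = 0

/-- The iterated brackets `[..[e i, e (i+1)].., e (j-1)]`. -/
def rootUp (e : ℕ → A) (i : ℕ) : ℕ → A
  | 0 => 0
  | j + 1 => if j = i then e i else ⁅rootUp e i j, e j⁆

/-- The iterated brackets `[f (i-1), ..[f (j+1), f j]..]`. -/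
def rootDown (f : ℕ → A) (j : ℕ) : ℕ → A
  | 0 => 0
  | i + 1 => if i = j then f j else ⁅f i, rootDown f j i⁆

/-- The element that corresponds to the matrix unit `E_{ij}` (indices starting at `0`). -/
def glE (h e f : ℕ → A) (i j : ℕ) : A :=
  if i = j then h i else if i < j then rootUp e i j else rootDown f j i

theorem GlRel.symm {n : ℕ} {h e f : ℕ → A} (H : GlRel n h e f) :
    GlRel n (fun k => -h k) (fun k => -f k) (fun k => -e k) where
  hh i j hi hj := by simp [H.hh i j hi hj]
  he i k hi hk := by
    simp only [neg_lie, lie_neg, neg_neg, H.hf i k hi hk, ← smul_neg]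
    simp only [smul_neg, ← neg_smul]; congr 1; ring
  hf i k hi hk := by
    simp only [neg_lie, lie_neg, neg_neg, H.he i k hi hk, ← smul_neg]
    simp only [smul_neg, ← neg_smul]; congr 1; ring
  ef k hk := by
    have := H.ef k hk
    rw [← lie_skew, neg_eq_iff_eq_neg] at this
    simp only [neg_lie, lie_neg, neg_neg, this]; abel
  ef' k l hk hl hkl := by
    have := H.ef' l k hl hk hkl.symm
    rw [← lie_skew, neg_eq_zero] at this
    simp [this]
  ee k l hl hk := by simp [H.ff k l hl hk]
  ff k l hl hk := by simp [H.ee k l hl hk]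
  se k hk := by simp [H.sf k hk]
  se' k hk := by simp [H.sf' k hk]
  sf k hk := by simp [H.se k hk]
  sf' k hk := by simp [H.se' k hk]

theorem rootUp_neg (f : ℕ → A) (i j : ℕ) :
    rootUp (fun k => -f k) i j = - rootDown f i j := by
  induction j with
  | zero => simp [rootUp, rootDown]
  | succ j ih =>
    simp only [rootUp, rootDown, ih]
    split_ifs
    · rfl
    · simp [lie_skew]

theorem rootDown_neg (e : ℕ → A) (i j : ℕ) :
    rootDown (fun k => -e k) i j = - rootUp e i j := by
  induction j with
  | zero => simp [rootUp, rootDown]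
  | succ j ih =>
    simp only [rootUp, rootDown, ih]
    split_ifs
    · rfl
    · simp [lie_skew]

theorem glE_symm (h e f : ℕ → A) (i j : ℕ) :
    glE (fun k => -h k) (fun k => -f k) (fun k => -e k) i j = - glE h e f j i := by
  unfold glE
  rcases lt_trichotomy i j with hij | rfl | hij
  · simp [hij.ne, hij.ne', hij, hij.not_gt, rootUp_neg]
  · simp
  · simp [hij.ne, hij.ne', hij, hij.not_gt, rootDown_neg]

theorem lie_zero_of {a x y : A} (hx : ⁅a, x⁆ = 0) (hy : ⁅a, y⁆ = 0) : ⁅a, ⁅x, y⁆⁆ = 0 := by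
  rw [leibniz_lie, hx, hy]; simp

theorem glE_local {h e f : ℕ → A} {q : ℕ} {a : A} (ah : ∀ k < q, ⁅a, h k⁆ = 0)
    (ae : ∀ k, k + 1 < q → ⁅a, e k⁆ = 0) (af : ∀ k, k + 1 < q → ⁅a, f k⁆ = 0) {i j : ℕ}
    (hi : i < q) (hj : j < q) : ⁅a, glE h e f i j⁆ = 0 := by
  have up : ∀ i j, j < q → ⁅a, rootUp e i j⁆ = 0 := by
    intro i j
    induction j with
    | zero => simp [rootUp]
    | succ j ih =>
      intro hj
      simp only [rootUp]
      split_ifs with hji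
      · subst hji; exact ae _ hj
      · exact lie_zero_of (ih (by omega)) (ae _ hj)
  have dn : ∀ i j, j < q → ⁅a, rootDown f i j⁆ = 0 := by
    intro i j
    induction j with
    | zero => simp [rootDown]
    | succ j ih =>
      intro hj
      simp only [rootDown]
      split_ifs with hji
      · subst hji; exact af _ hj
      · exact lie_zero_of (af _ hj) (ih (by omega))
  unfold glE
  split_ifs with h1 h2
  · exact ah _ hi
  · exact up _ _ hj
  · exact dn _ _ hi

/-- The commutation relations of matrix units, for indices below `m`. -/
def MatRel (m : ℕ) (E : ℕ → ℕ → A) : Prop :=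
  ∀ i j k l, i < m → j < m → k < m → l < m →
    ⁅E i j, E k l⁆ = (if j = k then E i l else 0) - (if l = i then E k j else 0)

section Step
variable {n m : ℕ} {h e f : ℕ → A}

theorem glE_self (h e f : ℕ → A) (i : ℕ) : glE h e f i i = h i := by simp [glE]

theorem glE_up (h e f : ℕ → A) (i : ℕ) : glE h e f i (i + 1) = e i := by simp [glE, rootUp]

theorem glE_down (h e f : ℕ → A) (i : ℕ) : glE h e f (i + 1) i = f i := by simp [glE, rootDown]

theorem glE_up' (h e f : ℕ → A) {i p : ℕ} (hi : i < p) :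
    glE h e f i (p + 1) = ⁅glE h e f i p, e p⁆ := by
  simp [glE, rootUp, hi.ne, hi.ne', hi, (show i < p + 1 by omega), (show i ≠ p + 1 by omega)]

theorem glE_down' (h e f : ℕ → A) {j p : ℕ} (hj : j < p) :
    glE h e f (p + 1) j = ⁅f p, glE h e f p j⁆ := by
  simp [glE, rootDown, hj.ne, hj.ne', hj.not_gt, (show ¬ p + 1 < j by omega),
    (show p + 1 ≠ j by omega)]

theorem step_a (H : GlRel n h e f) {p : ℕ} (hp : p + 1 < n) {i j : ℕ} (hi : i < p + 1)
    (hj : j < p) : ⁅glE h e f i j, e p⁆ = 0 := by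
  have loc : ∀ i j, i < p → j < p → ⁅e p, glE h e f i j⁆ = 0 := by
    intro i j hi hj
    refine glE_local (fun k hk => ?_) (fun k hk => ?_) (fun k hk => ?_) hi hj
    · rw [← lie_skew, H.he k p (by omega) hp, if_neg (by omega), if_neg (by omega)]; simp
    · rw [← lie_skew, H.ee k p hp (by omega)]; simp
    · rw [H.ef' p k hp (by omega) (by omega)]
  rw [← lie_skew, neg_eq_zero]
  rcases (show i < p ∨ i = p by omega) with hi | rfl
  · exact loc i j hi hj
  · obtain ⟨q, rfl⟩ : ∃ q, i = q + 1 := ⟨i - 1, by omega⟩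
    rcases (show j < q ∨ j = q by omega) with hj | rfl
    · rw [glE_down' _ _ _ hj]
      exact lie_zero_of (H.ef' _ _ hp (by omega) (by omega)) (loc _ _ (by omega) (by omega))
    · rw [glE_down]; exact H.ef' _ _ hp (by omega) (by omega)

theorem step_b (H : GlRel n h e f) {p : ℕ} (hp : p + 1 < n) {i : ℕ} (hi : i < p + 1) :
    ⁅glE h e f i p, e p⁆ = glE h e f i (p + 1) := by
  rcases (show i < p ∨ i = p by omega) with hi | rfl
  · rw [glE_up' _ _ _ hi]
  · rw [glE_self, glE_up, H.he _ _ (by omega) hp]; simp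

theorem step_c (H : GlRel n h e f) (hm : m < n) {i j : ℕ} (hi : i < m) (hj : j < m) :
    ⁅h m, glE h e f i j⁆ = 0 := by
  refine glE_local (fun k hk => ?_) (fun k hk => ?_) (fun k hk => ?_) hi hj
  · exact H.hh _ _ hm (by omega)
  · rw [H.he _ _ hm (by omega), if_neg (by omega), if_neg (by omega)]; simp
  · rw [H.hf _ _ hm (by omega), if_neg (by omega), if_neg (by omega)]; simp

theorem step_d (H : GlRel n h e f) {p : ℕ} (hp : p + 1 < n) (IH : MatRel (p + 1) (glE h e f))
    {i j k : ℕ} (hi : i < p + 1) (hj : j < p + 1) (hk : k < p + 1) :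
    ⁅glE h e f i j, glE h e f k (p + 1)⁆ = if j = k then glE h e f i (p + 1) else 0 := by
  set E := glE h e f with hE
  -- the case `j < p`
  have main : ∀ i j k, i < p + 1 → j < p → k < p + 1 →
      ⁅E i j, E k (p + 1)⁆ = if j = k then E i (p + 1) else 0 := by
    intro i j k hi hj hk
    rw [hE, ← step_b H hp hk, leibniz_lie, step_a H hp hi hj, ← hE,
      IH i j k p hi (by omega) hk (by omega), lie_zero, add_zero, sub_lie]
    have h2 : ⁅(if p = i then E k j else 0), e p⁆ = 0 := by
      split_ifs
      · exact step_a H hp hk hj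
      · simp
    rw [h2, sub_zero]
    split_ifs
    · exact step_b H hp hi
    · simp
  rcases (show j < p ∨ j = p by omega) with hj' | rfl
  · exact main i j k hi hj' hk
  rcases (show k < j ∨ k = j by omega) with hk' | rfl
  swap
  · rw [if_pos rfl, hE, glE_up]; exact step_b H hp hi
  rw [if_neg (by omega)]
  -- `⁅E i p, E k (p+1)⁆ = 0` for `k < p`
  obtain ⟨q, rfl⟩ : ∃ q, j = q + 1 := ⟨j - 1, by omega⟩
  set p := q + 1 with hpq
  rcases (show i < p ∨ i = p by omega) with hi' | rfl
  swap
  · have hA : ⁅h p, E k p⁆ = - E k p := by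
      have := IH p p k p (by omega) (by omega) hk (by omega)
      rw [if_neg (by omega), if_pos rfl, zero_sub] at this
      rwa [hE, glE_self] at this
    have hB : ⁅h p, e p⁆ = e p := by
      rw [H.he _ _ (by omega) hp, if_pos rfl, if_neg (by omega)]; simp
    rw [hE, glE_self, ← step_b H hp hk, leibniz_lie, ← hE, hA, hB, neg_lie, neg_add_cancel]
  have h0 : ⁅E q p, E q (p + 1)⁆ = 0 := by
    rw [hE, ← step_b H hp (show q < p + 1 by omega), hpq, glE_up]
    exact H.se q (by omega)
  have h1 : ∀ i, i < p → ⁅E i p, E q (p + 1)⁆ + ⁅E q p, E i (p + 1)⁆ = 0 := by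
    intro i hi
    rcases (show i < q ∨ i = q by omega) with hi' | rfl
    swap
    · rw [h0]; simp
    have := congrArg (fun x => ⁅E i q, x⁆) h0
    simp only [lie_zero] at this
    rw [leibniz_lie, IH _ _ _ _ (by omega) (by omega) (by omega) (by omega),
      main _ _ _ (by omega) (by omega) (by omega), if_pos rfl, if_pos rfl, if_neg (by omega),
      sub_zero] at this
    exact this
  -- symmetry in the two indices
  have sym : ∀ i k, i < p → k < p → ⁅E i p, E k (p + 1)⁆ = ⁅E k p, E i (p + 1)⁆ := by
    intro i k hi hk
    conv_lhs => rw [hE, ← step_b H hp (show k < p + 1 by omega)]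
    rw [leibniz_lie, ← hE, IH _ _ _ _ (by omega) (by omega) (by omega) (by omega),
      if_neg (by omega), if_neg (by omega), sub_zero, zero_lie, zero_add, hE,
      step_b H hp (by omega)]
  have two : ∀ x : A, x + x = 0 → x = 0 := by
    intro x hx
    have : (2 : ℂ) • x = 0 := by rw [two_smul]; exact hx
    simpa using this
  have h2 : ∀ i, i < p → ⁅E i p, E q (p + 1)⁆ = 0 := by
    intro i hi
    have := h1 i hi
    rw [sym q i (by omega) hi] at this
    exact two _ this
  rcases (show k < q ∨ k = q by omega) with hk'' | rfl
  swap
  · exact h2 i hi'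
  have := congrArg (fun x => ⁅E k q, x⁆) (h2 i hi')
  simp only [lie_zero] at this
  rw [leibniz_lie, IH _ _ _ _ (by omega) (by omega) (by omega) (by omega),
      main _ _ _ (by omega) (by omega) (by omega), if_pos rfl, if_neg (by omega : ¬ p = k),
      sub_zero] at this
  split_ifs at this with hqi
  · subst hqi
    rw [sym q k (by omega) (by omega)]
    exact h2 k hk'
  · simpa using this

theorem matRel_symm (IH : MatRel m (glE h e f)) :
    MatRel m (glE (fun k => -h k) (fun k => -f k) (fun k => -e k)) := by
  intro i j k l hi hj hk hl
  simp only [glE_symm, neg_lie, lie_neg, neg_neg, IH j i l k hj hi hl hk]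
  simp only [eq_comm (a := i) (b := l), eq_comm (a := k) (b := j)]
  split_ifs <;> abel

theorem step_d' (H : GlRel n h e f) {p : ℕ} (hp : p + 1 < n) (IH : MatRel (p + 1) (glE h e f))
    {i j k : ℕ} (hi : i < p + 1) (hj : j < p + 1) (hk : k < p + 1) :
    ⁅glE h e f i j, glE h e f (p + 1) k⁆ = - if i = k then glE h e f (p + 1) j else 0 := by
  have := step_d H.symm hp (matRel_symm IH) hj hi hk
  simp only [glE_symm, neg_lie, lie_neg, neg_neg] at this
  rw [this]
  split_ifs <;> simp

theorem step_f (H : GlRel n h e f) {p : ℕ} (hp : p + 1 < n) (IH : MatRel (p + 1) (glE h e f))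
    {i k : ℕ} (hi : i < p + 1) (hk : k < p + 1) :
    ⁅glE h e f i (p + 1), glE h e f k (p + 1)⁆ = 0 := by
  set E := glE h e f with hE
  have d := fun {i j k : ℕ} (hi : i < p + 1) (hj : j < p + 1) (hk : k < p + 1) =>
    step_d H hp IH hi hj hk
  rw [← hE] at d
  rcases Nat.eq_zero_or_pos p with rfl | hp0
  · obtain rfl : i = 0 := by omega
    obtain rfl : k = 0 := by omega
    simp
  obtain ⟨q, rfl⟩ : ∃ q, p = q + 1 := ⟨p - 1, by omega⟩
  set p := q + 1 with hpq
  have h0 : ⁅E p (p + 1), E q (p + 1)⁆ = 0 := by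
    rw [hE, ← step_b H hp (show q < p + 1 by omega), hpq, glE_up, glE_up]
    rw [← lie_skew (e q), lie_neg, H.se' q (by omega), neg_zero]
  have h1 : ∀ i, i < p + 1 → ⁅E p (p + 1), E i (p + 1)⁆ = 0 := by
    intro i hi
    rcases (show i < q ∨ i = q ∨ i = p by omega) with hi' | rfl | rfl
    · have := congrArg (fun x => ⁅E i q, x⁆) h0
      simp only [lie_zero] at this
      rw [leibniz_lie, d (by omega) (by omega) (by omega), d (by omega) (by omega) (by omega),
        if_neg (by omega), if_pos rfl] at this
      simpa using this
    · exact h0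
    · simp
  rcases (show k < p ∨ k = p by omega) with hk' | rfl
  · have := congrArg (fun x => ⁅E i p, x⁆) (h1 k hk)
    simp only [lie_zero] at this
    rw [leibniz_lie, d (by omega) (by omega) (by omega), d (by omega) (by omega) (by omega),
        if_pos rfl, if_neg (by omega)] at this
    simpa using this
  · rw [← lie_skew, h1 i hi, neg_zero]

theorem step_f' (H : GlRel n h e f) {p : ℕ} (hp : p + 1 < n) (IH : MatRel (p + 1) (glE h e f))
    {i k : ℕ} (hi : i < p + 1) (hk : k < p + 1) :
    ⁅glE h e f (p + 1) i, glE h e f (p + 1) k⁆ = 0 := by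
  have := step_f H.symm hp (matRel_symm IH) hi hk
  simpa only [glE_symm, neg_lie, lie_neg, neg_neg] using this

theorem step_g (H : GlRel n h e f) {p : ℕ} (hp : p + 1 < n) (IH : MatRel (p + 1) (glE h e f))
    {i k : ℕ} (hi : i < p + 1) (hk : k < p + 1) :
    ⁅glE h e f i (p + 1), glE h e f (p + 1) k⁆ =
      glE h e f i k - if i = k then h (p + 1) else 0 := by
  have c := fun {i j : ℕ} (hi : i < p + 1) (hj : j < p + 1) => step_c H hp hi hj
  set E := glE h e f with hE
  have d := fun {i j k : ℕ} (hi : i < p + 1) (hj : j < p + 1) (hk : k < p + 1) =>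
    step_d H hp IH hi hj hk
  have d' := fun {i j k : ℕ} (hi : i < p + 1) (hj : j < p + 1) (hk : k < p + 1) =>
    step_d' H hp IH hi hj hk
  rw [← hE] at d d'
  have c' : ∀ {i j : ℕ}, i < p + 1 → j < p + 1 → ⁅E i j, h (p + 1)⁆ = 0 := by
    intro i j hi hj
    rw [← lie_skew, c hi hj, neg_zero]
  have h0 : ⁅E p (p + 1), E (p + 1) p⁆ = E p p - h (p + 1) := by
    rw [hE, glE_up, glE_down, glE_self]; exact H.ef p hp
  have h1 : ∀ i, i < p + 1 → ⁅E i (p + 1), E (p + 1) p⁆ = E i p - if i = p then h (p + 1) else 0 := by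
    intro i hi
    rcases (show i < p ∨ i = p by omega) with hi' | rfl
    swap
    · rw [h0, if_pos rfl]
    have := congrArg (fun x => ⁅E i p, x⁆) h0
    beta_reduce at this
    rw [leibniz_lie, d (by omega) (by omega) (by omega), d' (by omega) (by omega) (by omega),
      lie_sub, c' hi (by omega), IH _ _ _ _ (by omega) (by omega) (by omega) (by omega)] at this
    simpa [hi'.ne, hi'.ne'] using this
  rcases (show k < p ∨ k = p by omega) with hk' | rfl
  swap
  · exact h1 i hi
  have := congrArg (fun x => ⁅E p k, x⁆) (h1 i hi)
  beta_reduce at this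
  rw [leibniz_lie, d (by omega) (by omega) (by omega), d' (by omega) (by omega) (by omega),
      lie_sub, IH _ _ _ _ (by omega) (by omega) (by omega) (by omega), if_pos rfl, if_pos rfl] at this
  have h3 : ⁅E p k, (if i = p then h (p + 1) else 0)⁆ = 0 := by
    split_ifs
    · exact c' (by omega) hk
    · simp
  rw [h3, lie_neg] at this
  have h4 : ⁅(if k = i then E p (p + 1) else 0), E (p + 1) p⁆ =
      if k = i then E p p - h (p + 1) else 0 := by
    split_ifs
    · exact h0
    · simp
  rw [h4] at this
  simp only [eq_comm (a := i) (b := k)]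
  have : ⁅E i (p + 1), E (p + 1) k⁆ =
    (if k = i then E p p - h (p + 1) else 0) - (((if k = i then E p p else 0) - E i k) - 0) := by
    rw [← this]; abel
  rw [this]
  split_ifs <;> abel

theorem step_h (H : GlRel n h e f) {p : ℕ} (hp : p + 1 < n)
    {i : ℕ} (hi : i < p + 1) :
    ⁅h (p + 1), glE h e f i (p + 1)⁆ = - glE h e f i (p + 1) := by
  rw [← step_b H hp hi, leibniz_lie, step_c H hp hi (by omega), H.he _ _ hp hp]
  simp

theorem step_h' (H : GlRel n h e f) {p : ℕ} (hp : p + 1 < n)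
    {i : ℕ} (hi : i < p + 1) :
    ⁅h (p + 1), glE h e f (p + 1) i⁆ = glE h e f (p + 1) i := by
  have := step_h H.symm hp hi
  simpa only [glE_symm, neg_lie, lie_neg, neg_neg] using this

theorem glE_matRel (H : GlRel n h e f) : ∀ m, m ≤ n → MatRel m (glE h e f) := by
  intro m
  induction m with
  | zero => intro _ i j k l hi; omega
  | succ m ih =>
    intro hm
    have IH := ih (by omega)
    rcases Nat.eq_zero_or_pos m with rfl | hm0
    · intro i j k l hi hj hk hl
      obtain rfl : i = 0 := by omega
      obtain rfl : j = 0 := by omega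
      obtain rfl : k = 0 := by omega
      obtain rfl : l = 0 := by omega
      simp
    obtain ⟨p, rfl⟩ : ∃ p, m = p + 1 := ⟨m - 1, by omega⟩
    have hp : p + 1 < n := by omega
    have c : ∀ {i j : ℕ}, i < p + 1 → j < p + 1 →
      ⁅glE h e f i j, h (p + 1)⁆ = 0 := fun hi hj => by
        rw [← lie_skew, step_c H hp hi hj, neg_zero]
    intro i j k l hi hj hk hl
    rcases (show i < p + 1 ∨ i = p + 1 by omega) with hi | rfl <;>
    rcases (show j < p + 1 ∨ j = p + 1 by omega) with hj | rfl <;>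
    rcases (show k < p + 1 ∨ k = p + 1 by omega) with hk | rfl <;>
    rcases (show l < p + 1 ∨ l = p + 1 by omega) with hl | rfl
    · exact IH i j k l hi hj hk hl
    · rw [step_d H hp IH hi hj hk, if_neg (by omega : ¬ p + 1 = i), sub_zero]
    · rw [step_d' H hp IH hi hj hl, if_neg (by omega : ¬ j = p + 1), zero_sub]
      simp only [eq_comm]
    · rw [glE_self, c hi hj, if_neg (by omega), if_neg (by omega), sub_zero]
    · rw [← lie_skew, step_d H hp IH hk hl hi, if_neg (by omega : ¬ p + 1 = k), zero_sub]
    · rw [step_f H hp IH hi hk, if_neg (by omega), if_neg (by omega), sub_zero]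
    · rw [step_g H hp IH hi hl, if_pos rfl, glE_self]
      simp only [eq_comm]
    · rw [glE_self, ← lie_skew, step_h H hp hi, if_pos rfl, if_neg (by omega), sub_zero, neg_neg]
    · rw [← lie_skew, step_d' H hp IH hk hl hj, if_neg (by omega : ¬ l = p + 1), neg_neg, sub_zero]
      simp only [eq_comm]
    · rw [← lie_skew, step_g H hp IH hk hj, if_pos rfl, glE_self, neg_sub]
      simp only [eq_comm]
    · rw [step_f' H hp IH hj hl, if_neg (by omega), if_neg (by omega), sub_zero]
    · rw [glE_self, ← lie_skew, step_h' H hp hj, if_neg (by omega), if_pos rfl, zero_sub]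
    · rw [glE_self, step_c H hp hk hl, if_neg (by omega), if_neg (by omega), sub_zero]
    · rw [glE_self, step_h H hp hk, if_neg (by omega), if_pos rfl, zero_sub]
    · rw [glE_self, step_h' H hp hl, if_pos rfl, if_neg (by omega), sub_zero]
    · simp
end Step

/-- The Lie algebra homomorphism out of `gl(n)` that sends the matrix units to `glE h e f i j`. -/
def glHom {n : ℕ} {h e f : ℕ → A} (H : GlRel n h e f) :
    Matrix (Fin n) (Fin n) ℂ →ₗ⁅ℂ⁆ A where
  toFun M := ∑ i, ∑ j, M i j • glE h e f i j
  map_add' M N := by simp [add_smul, Finset.sum_add_distrib]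
  map_smul' c M := by simp [Finset.smul_sum, smul_smul]
  map_lie' {M N} := by
    have R := glE_matRel H n le_rfl
    have e1 : ∀ i j k l : Fin n, ⁅M i j • glE h e f i j, N k l • glE h e f k l⁆ =
        (if j = k then (M i j * N k l) • glE h e f i l else 0)
        - (if l = i then (M i j * N k l) • glE h e f k j else 0) := by
      intro i j k l
      rw [smul_lie, lie_smul, smul_smul, R i j k l i.2 j.2 k.2 l.2, smul_sub]
      simp only [Fin.val_inj]
      split_ifs <;> simp
    simp only [LieRing.of_associative_ring_bracket, Matrix.sub_apply, Matrix.mul_apply,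
      sum_lie, lie_sum, e1, sub_smul, Finset.sum_smul, Finset.sum_sub_distrib]
    congr 1
    · simp only [Finset.sum_ite_eq', Finset.sum_ite_eq, Finset.mem_univ, if_true]
      rw [Finset.sum_comm_cycle]
      refine Finset.sum_congr rfl fun x _ => ?_
      rw [Finset.sum_comm]
    · refine Finset.sum_congr rfl fun x _ => ?_
      rw [Finset.sum_comm]
      refine Finset.sum_congr rfl fun y _ => ?_
      rw [Finset.sum_comm]
      simp only [Finset.sum_ite_eq', Finset.sum_ite_eq, Finset.mem_univ, if_true, mul_comm]

theorem glHom_single {n : ℕ} {h e f : ℕ → A} (H : GlRel n h e f) (i j : Fin n) :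
    glHom H (Matrix.single i j 1) = glE h e f i j := by
  show ∑ a, ∑ b, (Matrix.single i j (1 : ℂ)) a b • glE h e f a b = _
  rw [Finset.sum_eq_single i, Finset.sum_eq_single j]
  · simp
  · intro b _ hb; simp [Matrix.single_apply, hb.symm]
  · simp
  · intro a _ ha
    apply Finset.sum_eq_zero
    intro b _; simp [Matrix.single_apply, ha.symm]
  · simp
end Abstract
/-! ### The Gelfand--Tsetlin operators of a generic tableau satisfy the relations of `gl(n)` -/

section Verification

variable {n : ℕ}

theorem entry_move {L : Tableau n} (R : lattice L) {k i : ℕ} (s : ℤ) (hk : k < n) (hi : 1 ≤ i)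
    (hik : i ≤ k) (a b : ℕ) :
    entry (move R k i s).1 a b = entry R.1 a b + if a = k ∧ b = i then (s : ℂ) else 0 := by
  unfold move entry
  rw [dif_pos hk]
  split_ifs with h1 h2 h3
  all_goals simp_all
  omega

theorem lattice_ext {L : Tableau n} {R Q : lattice L} (h : ∀ a b, entry R.1 a b = entry Q.1 a b) :
    R = Q := by
  apply Subtype.ext
  funext p
  have := h p.1.1 p.1.2
  unfold entry at this
  rwa [dif_pos p.2, dif_pos p.2] at this

theorem generic_of_mem {L : Tableau n} (hL : IsGeneric L) (R : lattice L) : IsGeneric R.1 := by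
  intro k i j hi hik hj hjk hk hij m
  obtain ⟨z, hz, hR⟩ := R.2
  have := hL k i j hi hik hj hjk hk hij
    (m - z ⟨(k, i), hi, hik, hk.le⟩ + z ⟨(k, j), hj, hjk, hk.le⟩)
  intro h
  apply this
  push_cast
  rw [← h]
  unfold entry
  rw [dif_pos ⟨hi, hik, hk.le⟩, dif_pos ⟨hj, hjk, hk.le⟩, dif_pos ⟨hi, hik, hk.le⟩,
    dif_pos ⟨hj, hjk, hk.le⟩, hR, hR]
  ring

variable {L : Tableau n}

theorem stepOp_single (k r : ℕ) (s : ℤ) (R : lattice L) :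
    stepOp L k r s (Finsupp.single R 1) =
      ∑ i ∈ Icc 1 k, stepCoeff R.1 k r i • Finsupp.single (move R k i s) (1 : ℂ) := by
  simp [stepOp]

theorem gtDiag_single (k : ℕ) (R : lattice L) :
    gtDiag L k (Finsupp.single R 1) = diagCoeff R.1 k • Finsupp.single R (1 : ℂ) := by
  simp [gtDiag]

theorem end_ext {S T : Module.End ℂ (lattice L →₀ ℂ)}
    (h : ∀ R, S (Finsupp.single R 1) = T (Finsupp.single R 1)) : S = T := by
  ext R : 2
  simpa using h R

theorem move_comm (R : lattice L) {k i k' i' : ℕ} (s s' : ℤ) (hk : k < n) (hi : 1 ≤ i)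
    (hik : i ≤ k) (hk' : k' < n) (hi' : 1 ≤ i') (hik' : i' ≤ k') :
    move (move R k i s) k' i' s' = move (move R k' i' s') k i s := by
  apply lattice_ext
  intro a b
  simp only [entry_move _ _ hk hi hik, entry_move _ _ hk' hi' hik']
  ring

theorem move_cancel (R : lattice L) {k i : ℕ} (s : ℤ) (hk : k < n) (hi : 1 ≤ i)
    (hik : i ≤ k) : move (move R k i s) k i (-s) = R := by
  apply lattice_ext
  intro a b
  simp only [entry_move _ _ hk hi hik]
  split_ifs <;> simp

theorem entry_move_row (R : lattice L) {k i : ℕ} (s : ℤ) (hk : k < n) (hi : i ∈ Icc 1 k) {a : ℕ}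
    (ha : a ≠ k) (b : ℕ) : entry (move R k i s).1 a b = entry R.1 a b := by
  rw [mem_Icc] at hi
  rw [entry_move _ _ hk hi.1 hi.2, if_neg (by tauto), add_zero]

theorem entry_move_col (R : lattice L) {k i : ℕ} (s : ℤ) (hk : k < n) (hi : i ∈ Icc 1 k) (a : ℕ)
    {b : ℕ} (hb : b ≠ i) : entry (move R k i s).1 a b = entry R.1 a b := by
  rw [mem_Icc] at hi
  rw [entry_move _ _ hk hi.1 hi.2, if_neg (by tauto), add_zero]

theorem entry_move_self (R : lattice L) {k i : ℕ} (s : ℤ) (hk : k < n) (hi : i ∈ Icc 1 k) :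
    entry (move R k i s).1 k i = entry R.1 k i + s := by
  rw [mem_Icc] at hi
  rw [entry_move _ _ hk hi.1 hi.2, if_pos ⟨rfl, rfl⟩]

/-- `∏ (u - r_{rj})` over a set of positions of row `r`. -/
def rowProd (R : Tableau n) (r : ℕ) (t : Finset ℕ) (u : ℂ) : ℂ := ∏ j ∈ t, (u - entry R r j)

theorem stepCoeff_eq (R : Tableau n) (k r i : ℕ) : stepCoeff R k r i =
    rowProd R r (Icc 1 r) (entry R k i) / rowProd R k ((Icc 1 k).erase i) (entry R k i) := rfl

theorem rowProd_move_row (R : lattice L) {k i : ℕ} (s : ℤ) (hk : k < n) (hi : i ∈ Icc 1 k) {r : ℕ}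
    (hr : r ≠ k) (t : Finset ℕ) (u : ℂ) :
    rowProd (move R k i s).1 r t u = rowProd R.1 r t u :=
  prod_congr rfl fun j _ => by rw [entry_move_row R s hk hi hr]

theorem rowProd_move_col (R : lattice L) {k i : ℕ} (s : ℤ) (hk : k < n) (hi : i ∈ Icc 1 k) (r : ℕ)
    {t : Finset ℕ} (ht : i ∉ t) (u : ℂ) :
    rowProd (move R k i s).1 r t u = rowProd R.1 r t u :=
  prod_congr rfl fun j hj => by rw [entry_move_col R s hk hi r (by rintro rfl; exact ht hj)]

theorem rowProd_split (R : Tableau n) (r : ℕ) {t : Finset ℕ} {j : ℕ} (hj : j ∈ t) (u : ℂ) :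
    rowProd R r t u = (u - entry R r j) * rowProd R r (t.erase j) u :=
  (mul_prod_erase t _ hj).symm

theorem rowProd_ne_zero (hL : IsGeneric L) (R : lattice L) {k : ℕ} (hk : k < n) {i : ℕ}
    (hi : i ∈ Icc 1 k) {t : Finset ℕ} (ht : t ⊆ (Icc 1 k).erase i) (m : ℤ) :
    rowProd R.1 k t (entry R.1 k i + m) ≠ 0 := by
  refine prod_ne_zero_iff.2 fun j hj => ?_
  have h1 := ht hj
  rw [mem_erase, mem_Icc] at h1
  rw [mem_Icc] at hi
  have := generic_of_mem hL R k i j hi.1 hi.2 h1.2.1 h1.2.2 hk h1.1.symm (-m)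
  intro h
  apply this
  push_cast
  linear_combination h

theorem lie_stepOp_eq_zero {k r k' r' : ℕ} {s s' : ℤ} (hk : k < n) (hk' : k' < n)
    (h : ∀ (R : lattice L), ∀ i ∈ Icc 1 k, ∀ j ∈ Icc 1 k',
      stepCoeff R.1 k' r' j * stepCoeff (move R k' j s').1 k r i =
        stepCoeff R.1 k r i * stepCoeff (move R k i s).1 k' r' j) :
    stepOp L k r s * stepOp L k' r' s' - stepOp L k' r' s' * stepOp L k r s = 0 := by
  apply end_ext
  intro R
  simp only [LinearMap.sub_apply, Module.End.mul_apply, stepOp_single, map_sum, map_smul,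
    LinearMap.zero_apply, smul_sum, smul_smul]
  rw [sum_comm, ← sum_sub_distrib]
  refine sum_eq_zero fun i hi => ?_
  rw [← sum_sub_distrib]
  refine sum_eq_zero fun j hj => ?_
  rw [h R i hi j hj]
  rw [mem_Icc] at hi hj
  rw [move_comm R s' s hk' hj.1 hj.2 hk hi.1 hi.2, sub_self]

theorem stepCoeff_move_far (R : lattice L) {k i : ℕ} (s : ℤ) (hk : k < n) (hi : i ∈ Icc 1 k)
    {a r : ℕ} (ha : a ≠ k) (hr : r ≠ k) (j : ℕ) :
    stepCoeff (move R k i s).1 a r j = stepCoeff R.1 a r j := by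
  simp only [stepCoeff_eq, entry_move_row R s hk hi ha, rowProd_move_row R s hk hi ha,
    rowProd_move_row R s hk hi hr]

theorem lie_stepOp_far {k r k' r' : ℕ} (s s' : ℤ) (hk : k < n) (hk' : k' < n) (h1 : k ≠ k')
    (h2 : k ≠ r') (h3 : k' ≠ r) : 
    stepOp L k r s * stepOp L k' r' s' - stepOp L k' r' s' * stepOp L k r s = 0 := by
  refine lie_stepOp_eq_zero hk hk' fun R i hi j hj => ?_
  rw [stepCoeff_move_far R s' hk' hj h1 h3.symm, stepCoeff_move_far R s hk hi h1.symm h2.symm,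
    mul_comm]

theorem stepCoeff_split (R : Tableau n) {k r i j : ℕ} (hj : j ∈ Icc 1 r) : stepCoeff R k r i =
    (entry R k i - entry R r j) * (rowProd R r ((Icc 1 r).erase j) (entry R k i) /
      rowProd R k ((Icc 1 k).erase i) (entry R k i)) := by
  rw [stepCoeff_eq, rowProd_split R r hj, mul_div_assoc]

theorem stepCoeff_move_near (R : lattice L) {k r i j : ℕ} (s : ℤ) (hr : r < n) (hkr : k ≠ r)
    (hj : j ∈ Icc 1 r) : stepCoeff (move R r j s).1 k r i =
    (entry R.1 k i - entry R.1 r j - s) * (rowProd R.1 r ((Icc 1 r).erase j) (entry R.1 k i) /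
      rowProd R.1 k ((Icc 1 k).erase i) (entry R.1 k i)) := by
  rw [stepCoeff_split _ hj, entry_move_row R s hr hj hkr, entry_move_self R s hr hj,
    rowProd_move_col R s hr hj _ (notMem_erase _ _), rowProd_move_row R s hr hj hkr]
  ring

theorem lie_stepOp_opp {k k' : ℕ} (s : ℤ) (hk : k < n) (hk' : k' < n) (h1 : k ≠ k') :
    
    stepOp L k k' s * stepOp L k' k (-s) - stepOp L k' k (-s) * stepOp L k k' s = 0 := by
  refine lie_stepOp_eq_zero hk hk' fun R i hi j hj => ?_
  rw [stepCoeff_move_near R _ hk' h1 hj, stepCoeff_move_near R _ hk h1.symm hi,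
    stepCoeff_split R.1 hi, stepCoeff_split R.1 hj]
  push_cast
  ring

theorem lie_lie_stepOp_eq_zero {k r k' r' : ℕ} {s s' : ℤ} (hk : k < n) (hk' : k' < n)
    (h : ∀ (R : lattice L), ∀ i ∈ Icc 1 k, ∀ i' ∈ Icc 1 k, ∀ j ∈ Icc 1 k',
      (stepCoeff R.1 k' r' j * stepCoeff (move R k' j s').1 k r i
          * stepCoeff (move (move R k i s) k' j s').1 k r i'
        - 2 * (stepCoeff R.1 k r i * stepCoeff (move R k i s).1 k' r' j
          * stepCoeff (move (move R k i s) k' j s').1 k r i')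
        + stepCoeff R.1 k r i * stepCoeff (move R k i s).1 k r i'
          * stepCoeff (move (move R k i s) k i' s).1 k' r' j)
      + (stepCoeff R.1 k' r' j * stepCoeff (move R k' j s').1 k r i'
          * stepCoeff (move (move R k i' s) k' j s').1 k r i
        - 2 * (stepCoeff R.1 k r i' * stepCoeff (move R k i' s).1 k' r' j
          * stepCoeff (move (move R k i' s) k' j s').1 k r i)
        + stepCoeff R.1 k r i' * stepCoeff (move R k i' s).1 k r i
          * stepCoeff (move (move R k i s) k i' s).1 k' r' j) = 0) :
    stepOp L k r s * stepOp L k r s * stepOp L k' r' s'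
      - 2 * (stepOp L k r s * stepOp L k' r' s' * stepOp L k r s)
      + stepOp L k' r' s' * stepOp L k r s * stepOp L k r s = 0 := by
  apply end_ext
  intro R
  have two : ∀ S : Module.End ℂ (lattice L →₀ ℂ), ∀ v, (2 * S) v = (2 : ℂ) • S v := by
    intro S v; rw [two_mul, LinearMap.add_apply, two_smul]
  simp only [LinearMap.sub_apply, LinearMap.add_apply, two, Module.End.mul_apply, stepOp_single,
    map_sum, map_smul, LinearMap.zero_apply, smul_sum, smul_smul]
  set F : ℕ → ℕ → ℕ → lattice L →₀ ℂ := fun i i' j =>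
    (stepCoeff R.1 k' r' j * stepCoeff (move R k' j s').1 k r i
          * stepCoeff (move (move R k i s) k' j s').1 k r i'
        - 2 * (stepCoeff R.1 k r i * stepCoeff (move R k i s).1 k' r' j
          * stepCoeff (move (move R k i s) k' j s').1 k r i')
        + stepCoeff R.1 k r i * stepCoeff (move R k i s).1 k r i'
          * stepCoeff (move (move R k i s) k i' s).1 k' r' j) •
      Finsupp.single (move (move (move R k i s) k i' s) k' j s') (1 : ℂ) with hF
  have key : ∑ i ∈ Icc 1 k, ∑ i' ∈ Icc 1 k, ∑ j ∈ Icc 1 k', F i i' j = 0 := by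
    have h2 : ∑ i ∈ Icc 1 k, ∑ i' ∈ Icc 1 k, ∑ j ∈ Icc 1 k', (F i i' j + F i' i j) = 0 := by
      refine sum_eq_zero fun i hi => sum_eq_zero fun i' hi' => sum_eq_zero fun j hj => ?_
      have := h R i hi i' hi' j hj
      rw [mem_Icc] at hi hi'
      rw [hF]
      simp only
      rw [move_comm R s s hk hi.1 hi.2 hk hi'.1 hi'.2] at this ⊢
      rw [← add_smul, this, zero_smul]
    simp only [sum_add_distrib] at h2
    rw [sum_comm (f := fun i i' => ∑ j ∈ Icc 1 k', F i' i j), ← two_smul ℂ] at h2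
    simpa using h2
  rw [← key, sum_comm]
  simp_rw [sum_comm (s := Icc 1 k') (t := Icc 1 k)]
  simp only [← sum_add_distrib, ← sum_sub_distrib]
  refine sum_congr rfl fun i hi => sum_congr rfl fun i' hi' => sum_congr rfl fun j hj => ?_
  rw [hF]
  rw [mem_Icc] at hi hi' hj
  simp only
  rw [move_comm R s' s hk' hj.1 hj.2 hk hi.1 hi.2,
    move_comm _ s' s hk' hj.1 hj.2 hk hi'.1 hi'.2, add_smul, sub_smul]
  simp only [mul_assoc]

theorem serre_one (hL : IsGeneric L) {k k' r' : ℕ} (s : ℤ) (hk : k < n) (hk' : k' < n)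
    (h1 : k ≠ k') (h2 : r' ≠ k) :
    stepOp L k k' s * stepOp L k k' s * stepOp L k' r' s
      - 2 * (stepOp L k k' s * stepOp L k' r' s * stepOp L k k' s)
      + stepOp L k' r' s * stepOp L k k' s * stepOp L k k' s = 0 := by
  refine lie_lie_stepOp_eq_zero hk hk' fun R i hi i' hi' j hj => ?_
  simp only [stepCoeff_move_far _ s hk hi h1.symm h2, stepCoeff_move_far _ s hk hi' h1.symm h2,
    stepCoeff_move_near _ s hk' h1 hj]
  simp only [stepCoeff_split _ hj, entry_move_row _ s hk hi h1.symm,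
    entry_move_row _ s hk hi' h1.symm, rowProd_move_row _ s hk hi h1.symm,
    rowProd_move_row _ s hk hi' h1.symm]
  rcases eq_or_ne i i' with rfl | hne
  · rw [entry_move_self R s hk hi]
    ring
  have hi1 : i' ∈ (Icc 1 k).erase i := mem_erase.2 ⟨hne.symm, hi'⟩
  have hi2 : i ∈ (Icc 1 k).erase i' := mem_erase.2 ⟨hne, hi⟩
  rw [entry_move_col R s hk hi k hne.symm, entry_move_col R s hk hi' k hne]
  rw [rowProd_split _ k hi1, rowProd_split _ k hi2, rowProd_split _ k hi1, rowProd_split _ k hi2,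
    entry_move_self R s hk hi, entry_move_self R s hk hi', 
    rowProd_move_col R s hk hi k (notMem_erase _ _),
    rowProd_move_col R s hk hi' k (notMem_erase _ _)]
  have n1 := rowProd_ne_zero hL R hk hi (erase_subset i' ((Icc 1 k).erase i)) 0
  have n2 := rowProd_ne_zero hL R hk hi' (erase_subset i ((Icc 1 k).erase i')) 0
  have n3 := rowProd_ne_zero hL R hk hi (singleton_subset_iff.2 hi1) 0
  have n4 := rowProd_ne_zero hL R hk hi (singleton_subset_iff.2 hi1) s
  have n5 := rowProd_ne_zero hL R hk hi' (singleton_subset_iff.2 hi2) s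
  simp only [rowProd, prod_singleton, Int.cast_zero, add_zero] at n3 n4 n5
  simp only [Int.cast_zero, add_zero] at n1 n2
  have n6 : entry R.1 k i' - entry R.1 k i ≠ 0 := by
    rw [← neg_sub]; exact neg_ne_zero.2 n3
  have n7 : entry R.1 k i' - (entry R.1 k i + s) ≠ 0 := by
    rw [← neg_sub]; exact neg_ne_zero.2 n4
  have n8 : entry R.1 k i - (entry R.1 k i' + s) ≠ 0 := by
    rw [← neg_sub]; exact neg_ne_zero.2 n5
  generalize rowProd R.1 k (((Icc 1 k).erase i).erase i') (entry R.1 k i) = D at *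
  generalize rowProd R.1 k (((Icc 1 k).erase i').erase i) (entry R.1 k i') = D' at *
  generalize rowProd R.1 k' ((Icc 1 k').erase j) (entry R.1 k i) = a1 at *
  generalize rowProd R.1 k' ((Icc 1 k').erase j) (entry R.1 k i') = a2 at *
  generalize entry R.1 k i = x at *
  generalize entry R.1 k i' = x' at *
  generalize entry R.1 k' j = y at *
  generalize (s : ℂ) = σ at *
  field_simp
  ring

theorem serre_two (hL : IsGeneric L) {k k' r : ℕ} (s : ℤ) (hk : k < n) (hk' : k' < n)
    (h1 : k ≠ k') (h2 : r ≠ k) (h3 : r ≠ k') :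
    stepOp L k r s * stepOp L k r s * stepOp L k' k s
      - 2 * (stepOp L k r s * stepOp L k' k s * stepOp L k r s)
      + stepOp L k' k s * stepOp L k r s * stepOp L k r s = 0 := by
  refine lie_lie_stepOp_eq_zero hk hk' fun R i hi i' hi' j hj => ?_
  simp only [stepCoeff_move_far _ s hk' hj h1 h3]
  simp only [stepCoeff_move_near _ s hk h1.symm hi, stepCoeff_move_near _ s hk h1.symm hi']
  rcases eq_or_ne i i' with rfl | hne
  · rw [stepCoeff_split _ hi, entry_move_self R s hk hi,
      rowProd_move_col R s hk hi k (notMem_erase _ _), entry_move_row R s hk hi h1.symm,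
      rowProd_move_row R s hk hi h1.symm]
    ring
  have hi1 : i' ∈ (Icc 1 k).erase i := mem_erase.2 ⟨hne.symm, hi'⟩
  have hi2 : i ∈ (Icc 1 k).erase i' := mem_erase.2 ⟨hne, hi⟩
  rw [stepCoeff_split R.1 hi, entry_move_row R s hk hi h1.symm, entry_move_col R s hk hi k hne.symm,
    rowProd_move_row R s hk hi h1.symm]
  simp only [stepCoeff_eq _ k r]
  rw [entry_move_col R s hk hi k hne.symm, entry_move_col R s hk hi' k hne,
    rowProd_move_row R s hk hi h2, rowProd_move_row R s hk hi' h2]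
  rw [rowProd_split R.1 k hi1 (entry R.1 k' j), rowProd_split R.1 k hi2 (entry R.1 k' j),
    rowProd_split (move R k i s).1 k hi2 (entry R.1 k' j)]
  rw [rowProd_split R.1 k hi1 (entry R.1 k i), rowProd_split R.1 k hi2 (entry R.1 k i'),
    rowProd_split (move R k i' s).1 k hi1 (entry R.1 k i),
    rowProd_split (move R k i s).1 k hi2 (entry R.1 k i'),
    entry_move_self R s hk hi, entry_move_self R s hk hi',
    rowProd_move_col R s hk hi k (notMem_erase _ _),
    rowProd_move_col R s hk hi' k (notMem_erase _ _),
    rowProd_move_col R s hk hi k (notMem_erase _ _)]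
  rw [erase_right_comm (a := i') (b := i)]
  have n1 := rowProd_ne_zero hL R hk hi (erase_subset i' ((Icc 1 k).erase i)) 0
  have n2 := rowProd_ne_zero hL R hk hi' (erase_subset i ((Icc 1 k).erase i')) 0
  rw [erase_right_comm] at n2
  have n3 := rowProd_ne_zero hL R hk hi (singleton_subset_iff.2 hi1) 0
  have n4 := rowProd_ne_zero hL R hk hi (singleton_subset_iff.2 hi1) s
  have n5 := rowProd_ne_zero hL R hk hi' (singleton_subset_iff.2 hi2) s
  simp only [rowProd, prod_singleton, Int.cast_zero, add_zero] at n3 n4 n5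
  simp only [Int.cast_zero, add_zero] at n1 n2
  have n6 : entry R.1 k i' - entry R.1 k i ≠ 0 := by
    rw [← neg_sub]; exact neg_ne_zero.2 n3
  have n7 : entry R.1 k i' - (entry R.1 k i + s) ≠ 0 := by
    rw [← neg_sub]; exact neg_ne_zero.2 n4
  have n8 : entry R.1 k i - (entry R.1 k i' + s) ≠ 0 := by
    rw [← neg_sub]; exact neg_ne_zero.2 n5
  generalize rowProd R.1 k (((Icc 1 k).erase i).erase i') (entry R.1 k i) = D at *
  generalize rowProd R.1 k (((Icc 1 k).erase i).erase i') (entry R.1 k i') = D' at *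
  generalize rowProd R.1 k (((Icc 1 k).erase i).erase i') (entry R.1 k' j) = D'' at *
  generalize rowProd R.1 k' ((Icc 1 k').erase j) (entry R.1 k' j) = a0 at *
  generalize rowProd R.1 r (Icc 1 r) (entry R.1 k i) = a1 at *
  generalize rowProd R.1 r (Icc 1 r) (entry R.1 k i') = a2 at *
  generalize entry R.1 k i = x at *
  generalize entry R.1 k i' = x' at *
  generalize entry R.1 k' j = y at *
  generalize (s : ℂ) = σ at *
  field_simp
  ring

open Polynomial in
theorem sum_eval_div {ι : Type*} [DecidableEq ι] (t : Finset ι) (v : ι → ℂ)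
    (hv : Set.InjOn v t) (ht : 0 < #t) {P : ℂ[X]} (hP : P.Monic) (hd : P.natDegree = #t) :
    ∑ i ∈ t, P.eval (v i) / ∏ j ∈ t.erase i, (v i - v j) = P.nextCoeff + ∑ i ∈ t, v i := by
  have hQ : (∏ i ∈ t, (X - C (v i))).Monic := monic_prod_of_monic _ _ fun i _ => monic_X_sub_C _
  have hQd : (∏ i ∈ t, (X - C (v i))).natDegree = #t := by
    rw [natDegree_prod_of_monic _ _ fun i _ => monic_X_sub_C _]; simp
  have hlt : (P - ∏ i ∈ t, (X - C (v i))).degree < #t := by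
    have := degree_sub_lt_left (p := P) (q := ∏ i ∈ t, (X - C (v i))) ?_ hP.ne_zero ?_
    · rwa [degree_eq_natDegree hP.ne_zero, hd] at this
    · rw [degree_eq_natDegree hP.ne_zero, degree_eq_natDegree hQ.ne_zero, hd, hQd]
    · rw [hP.leadingCoeff, hQ.leadingCoeff]
  have := Lagrange.coeff_eq_sum hv hlt
  rw [coeff_sub, prod_X_sub_C_coeff_card_pred t v ht] at this
  rw [nextCoeff_of_natDegree_pos (by omega), hd, ← sub_neg_eq_add, this]
  refine sum_congr rfl fun i hi => ?_
  rw [eval_sub, eval_prod, prod_eq_zero hi (by simp), sub_zero]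

theorem lie_ef_single (hL : IsGeneric L) {k r r' : ℕ} (s : ℤ) (hk : k < n) (hr : r ≠ k)
    (hr' : r' ≠ k) (R : lattice L) :
    (stepOp L k r s * stepOp L k r' (-s) - stepOp L k r' (-s) * stepOp L k r s)
      (Finsupp.single R 1) =
    (∑ i ∈ Icc 1 k, (stepCoeff R.1 k r' i * stepCoeff (move R k i (-s)).1 k r i -
      stepCoeff R.1 k r i * stepCoeff (move R k i s).1 k r' i)) • Finsupp.single R (1 : ℂ) := by
  simp only [LinearMap.sub_apply, Module.End.mul_apply, stepOp_single, map_sum, map_smul,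
    LinearMap.zero_apply, smul_sum, smul_smul]
  rw [sum_comm, ← sum_sub_distrib, sum_smul]
  refine sum_congr rfl fun i hi => ?_
  rw [← sum_sub_distrib, sum_eq_single i]
  · rw [mem_Icc] at hi
    have := move_cancel R (-s) hk hi.1 hi.2
    rw [neg_neg] at this
    rw [this, move_cancel R s hk hi.1 hi.2, sub_smul]
  · intro i' hi' hne
    have hm := hi
    have hm' := hi'
    rw [mem_Icc] at hm hm'
    rw [move_comm R (-s) s hk hm'.1 hm'.2 hk hm.1 hm.2, ← sub_smul]
    convert zero_smul ℂ _
    have hi1 : i' ∈ (Icc 1 k).erase i := mem_erase.2 ⟨hne, hi'⟩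
    have hi2 : i ∈ (Icc 1 k).erase i' := mem_erase.2 ⟨hne.symm, hi⟩
    simp only [stepCoeff_eq]
    rw [entry_move_col R s hk hi k hne, entry_move_col R _ hk hi' k hne.symm,
      rowProd_move_row R s hk hi hr', rowProd_move_row R _ hk hi' hr]
    rw [rowProd_split _ k hi1 (entry R.1 k i), rowProd_split _ k hi2 (entry R.1 k i'),
      rowProd_split _ k hi1 (entry R.1 k i), rowProd_split _ k hi2 (entry R.1 k i'),
      entry_move_self R s hk hi, entry_move_self R _ hk hi',
      rowProd_move_col R s hk hi k (notMem_erase _ _),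
      rowProd_move_col R _ hk hi' k (notMem_erase _ _)]
    have n1 := rowProd_ne_zero hL R hk hi (erase_subset i' ((Icc 1 k).erase i)) 0
    have n2 := rowProd_ne_zero hL R hk hi' (erase_subset i ((Icc 1 k).erase i')) 0
    have n3 := rowProd_ne_zero hL R hk hi (singleton_subset_iff.2 hi1) 0
    have n4 := rowProd_ne_zero hL R hk hi (singleton_subset_iff.2 hi1) s
    simp only [rowProd, prod_singleton, Int.cast_zero, add_zero] at n3 n4
    simp only [Int.cast_zero, add_zero] at n1 n2
    have n6 : entry R.1 k i' - entry R.1 k i ≠ 0 := by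
      rw [← neg_sub]; exact neg_ne_zero.2 n3
    have n7 : entry R.1 k i' - (entry R.1 k i + s) ≠ 0 := by
      rw [← neg_sub]; exact neg_ne_zero.2 n4
    have n8 : entry R.1 k i - (entry R.1 k i' + (-s : ℤ)) ≠ 0 := by
      push_cast; convert n4 using 1; ring
    push_cast at *
    field_simp
    ring
  · intro h; exact absurd hi h

theorem lagrange_ef (hL : IsGeneric L) {k : ℕ} (hk1 : 1 ≤ k) (hk : k < n) (R : lattice L) :
    ∑ i ∈ Icc 1 k, (stepCoeff R.1 k (k - 1) i * stepCoeff (move R k i (-1)).1 k (k + 1) i -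
      stepCoeff R.1 k (k + 1) i * stepCoeff (move R k i 1).1 k (k - 1) i) =
    diagCoeff R.1 (k + 1) - diagCoeff R.1 k := by
  classical
  set x : ℕ → ℂ := entry R.1 k with hx
  set y : ℕ → ℂ := entry R.1 (k + 1) with hy
  set z : ℕ → ℂ := entry R.1 (k - 1) with hz
  let P : Polynomial ℂ := (∏ j ∈ Icc 1 (k + 1), (Polynomial.X - Polynomial.C (y j))) *
    ∏ j ∈ Icc 1 (k - 1), (Polynomial.X - Polynomial.C (z j - 1))
  let t := (Icc 1 k).disjSum (Icc 1 k)
  let v : ℕ ⊕ ℕ → ℂ := Sum.elim x fun i => x i - 1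
  have m1 : (∏ j ∈ Icc 1 (k + 1), (Polynomial.X - Polynomial.C (y j))).Monic :=
    Polynomial.monic_prod_of_monic _ _ fun i _ => Polynomial.monic_X_sub_C _
  have m2 : (∏ j ∈ Icc 1 (k - 1), (Polynomial.X - Polynomial.C (z j - 1))).Monic :=
    Polynomial.monic_prod_of_monic _ _ fun i _ => Polynomial.monic_X_sub_C _
  have hgen : ∀ i ∈ Icc 1 k, ∀ j ∈ Icc 1 k, i ≠ j → ∀ m : ℤ, x i - x j ≠ m := by
    intro i hi j hj hij m
    rw [mem_Icc] at hi hj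
    exact generic_of_mem hL R k i j hi.1 hi.2 hj.1 hj.2 hk hij m
  have hv : Set.InjOn v t := by
    rintro (i | i) hi (j | j) hj hij <;>
    simp only [t, mem_coe, inl_mem_disjSum, inr_mem_disjSum] at hi hj <;>
    simp only [v, Sum.elim_inl, Sum.elim_inr] at hij
    · by_contra h
      exact hgen i hi j hj (by simpa using h) 0 (by push_cast; linear_combination hij)
    · rcases eq_or_ne i j with rfl | h
      · exact absurd hij (by intro h; simpa using congrArg (fun w => x i - w) h)
      · exact absurd (by push_cast; linear_combination hij) (hgen i hi j hj h (-1))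
    · rcases eq_or_ne i j with rfl | h
      · exact absurd hij (by intro h; simpa using congrArg (fun w => x i - w) h)
      · exact absurd (by push_cast; linear_combination hij) (hgen i hi j hj h 1)
    · by_contra h
      exact hgen i hi j hj (by simpa using h) 0 (by push_cast; linear_combination hij)
  have hcard : #t = 2 * k := by simp [t]; ring
  have main := sum_eval_div t v hv (by omega) (m1.mul m2) (by
    rw [m1.natDegree_mul m2, Polynomial.natDegree_prod_of_monic _ _ fun i _ =>
      Polynomial.monic_X_sub_C _, Polynomial.natDegree_prod_of_monic _ _ fun i _ =>
      Polynomial.monic_X_sub_C _, hcard]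
    simp only [Polynomial.natDegree_X_sub_C, sum_const, Nat.card_Icc, smul_eq_mul, mul_one]
    omega)
  rw [m1.nextCoeff_mul m2, Polynomial.prod_X_sub_C_nextCoeff, Polynomial.prod_X_sub_C_nextCoeff]
    at main
  have e1 : ∀ i, t.erase (Sum.inl i) = ((Icc 1 k).erase i).disjSum (Icc 1 k) := by
    intro i; ext (j | j) <;> simp [t]
  have e2 : ∀ i, t.erase (Sum.inr i) = (Icc 1 k).disjSum ((Icc 1 k).erase i) := by
    intro i; ext (j | j) <;> simp [t]
  have hsum : ∑ i ∈ t, v i = 2 * ∑ i ∈ Icc 1 k, x i - k := by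
    simp [t, v, sum_disjSum]; ring
  rw [hsum] at main
  have hR : diagCoeff R.1 (k + 1) - diagCoeff R.1 k =
      - (-∑ i ∈ Icc 1 (k + 1), y i + -∑ i ∈ Icc 1 (k - 1), (z i - 1)
        + (2 * ∑ i ∈ Icc 1 k, x i - k)) := by
    unfold diagCoeff
    simp only [add_tsub_cancel_right, ← hx, ← hy, ← hz, sum_sub_distrib, sum_const, Nat.card_Icc,
      nsmul_eq_mul, mul_one]
    have : ((k - 1 : ℕ) : ℂ) = k - 1 := by push_cast [hk1]; ring
    rw [this]
    push_cast
    ring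
  rw [hR, ← main]
  simp only [t]
  rw [sum_disjSum, ← sum_add_distrib, ← sum_neg_distrib]
  refine sum_congr rfl fun i hi => ?_
  have hP : ∀ u, Polynomial.eval u ((∏ j ∈ Icc 1 (k + 1), (Polynomial.X - Polynomial.C (y j))) *
      ∏ j ∈ Icc 1 (k - 1), (Polynomial.X - Polynomial.C (z j - 1))) =
      rowProd R.1 (k + 1) (Icc 1 (k + 1)) u * rowProd R.1 (k - 1) (Icc 1 (k - 1)) (u + 1) := by
    intro u
    rw [Polynomial.eval_mul, Polynomial.eval_prod, Polynomial.eval_prod]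
    simp only [Polynomial.eval_sub, Polynomial.eval_X, Polynomial.eval_C, rowProd]
    congr 1
    refine prod_congr rfl fun j _ => ?_
    rw [hz]; ring
  have hD1 : ∏ j ∈ t.erase (Sum.inl i), (v (Sum.inl i) - v j) =
      rowProd R.1 k ((Icc 1 k).erase i) (x i) * rowProd R.1 k ((Icc 1 k).erase i) (x i + 1) := by
    rw [e1, prod_disjSum]
    simp only [v, Sum.elim_inl, Sum.elim_inr]
    rw [← mul_prod_erase _ _ hi]
    simp only [rowProd, ← hx]
    rw [sub_sub_cancel, one_mul]
    congr 1
    exact prod_congr rfl fun j _ => by ring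
  have hD2 : ∏ j ∈ t.erase (Sum.inr i), (v (Sum.inr i) - v j) =
      - rowProd R.1 k ((Icc 1 k).erase i) (x i + (-1 : ℤ)) *
        rowProd R.1 k ((Icc 1 k).erase i) (x i) := by
    rw [e2, prod_disjSum]
    simp only [v, Sum.elim_inl, Sum.elim_inr]
    rw [← mul_prod_erase _ _ hi]
    simp only [rowProd, ← hx]
    rw [sub_right_comm, sub_self, zero_sub, neg_one_mul]
    congr 1
    · congr 1
      exact prod_congr rfl fun j _ => by push_cast; ring
    · exact prod_congr rfl fun j _ => by ring
  rw [hP, hP, hD1, hD2]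
  simp only [v, Sum.elim_inl, Sum.elim_inr, stepCoeff_eq, entry_move_self R _ hk hi, ← hx]
  rw [rowProd_move_row R _ hk hi (show k + 1 ≠ k by omega),
    rowProd_move_row R _ hk hi (show k - 1 ≠ k by omega),
    rowProd_move_col R _ hk hi k (notMem_erase _ _),
    rowProd_move_col R _ hk hi k (notMem_erase _ _), sub_add_cancel]
  have n1 := rowProd_ne_zero hL R hk hi (Finset.Subset.refl ((Icc 1 k).erase i)) 0
  have n2 := rowProd_ne_zero hL R hk hi (Finset.Subset.refl ((Icc 1 k).erase i)) 1
  have n3 := rowProd_ne_zero hL R hk hi (Finset.Subset.refl ((Icc 1 k).erase i)) (-1)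
  simp only [← hx, Int.cast_zero, add_zero, Int.cast_one] at n1 n2
  rw [← hx] at n3
  push_cast at *
  rw [← sub_eq_add_neg] at *
  field_simp
  ring

/-- Commutator of a diagonal operator and a step operator. -/
theorem lie_diag_step {k m r : ℕ} {s : ℤ} (w : ℂ)
    (hw : ∀ (R : lattice L), ∀ i ∈ Icc 1 k,
      diagCoeff (move R k i s).1 m - diagCoeff R.1 m = w) :
    gtDiag L m * stepOp L k r s - stepOp L k r s * gtDiag L m = w • stepOp L k r s := by
  apply end_ext
  intro R
  simp only [LinearMap.sub_apply, LinearMap.smul_apply, Module.End.mul_apply, stepOp_single,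
    gtDiag_single, map_sum, map_smul, smul_sum, smul_smul]
  rw [← sum_sub_distrib]
  refine sum_congr rfl fun i hi => ?_
  rw [← hw R i hi, ← sub_smul]
  congr 1
  ring

theorem sum_entry_move (R : lattice L) {k i : ℕ} (s : ℤ) (hk : k < n) (hi : i ∈ Icc 1 k) (m : ℕ) :
    ∑ j ∈ Icc 1 m, entry (move R k i s).1 m j =
      ∑ j ∈ Icc 1 m, entry R.1 m j + if m = k then (s : ℂ) else 0 := by
  have hi' := hi
  rw [mem_Icc] at hi'
  simp only [entry_move R s hk hi'.1 hi'.2, sum_add_distrib]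
  congr 1
  split_ifs with h
  · subst h
    simp [hi'.1, hi'.2]
  · simp [h]

theorem diagCoeff_move (R : lattice L) {k i : ℕ} (s : ℤ) (hk : k < n) (hi : i ∈ Icc 1 k) (m : ℕ) :
    diagCoeff (move R k i s).1 m - diagCoeff R.1 m =
      s * ((if m = k then 1 else 0) - if m - 1 = k then 1 else 0) := by
  unfold diagCoeff
  rw [sum_entry_move R s hk hi, sum_entry_move R s hk hi]
  split_ifs <;> ring

section Ring
variable {𝓡 : Type*} [Ring 𝓡] {a b c d : 𝓡}

theorem brk_neg_neg (h : a * b - b * a = 0) : ⁅-a, -b⁆ = 0 := by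
  rw [LieRing.of_associative_ring_bracket, neg_mul_neg, neg_mul_neg, h]

theorem brk_neg_left (h : a * b - b * a = c - d) : ⁅-a, b⁆ = d - c := by
  rw [LieRing.of_associative_ring_bracket, neg_mul, mul_neg, ← neg_sub', h, neg_sub]

theorem brk_neg_left_zero (h : a * b - b * a = 0) : ⁅-a, b⁆ = 0 := by
  rw [LieRing.of_associative_ring_bracket, neg_mul, mul_neg, ← neg_sub', h, neg_zero]

theorem brk_neg_right [Algebra ℂ 𝓡] {w : ℂ} (h : a * b - b * a = w • b) : ⁅a, -b⁆ = w • -b := by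
  rw [LieRing.of_associative_ring_bracket, neg_mul, mul_neg, ← neg_sub', h, smul_neg]

theorem brk_serre (h : a * a * b - 2 * (a * b * a) + b * a * a = 0) : ⁅a, ⁅a, b⁆⁆ = 0 := by
  simp only [LieRing.of_associative_ring_bracket]
  rw [← h]
  noncomm_ring

theorem brk_serre_neg (h : a * a * b - 2 * (a * b * a) + b * a * a = 0) :
    ⁅-a, ⁅-a, -b⁆⁆ = 0 := by
  have := brk_serre h
  simp only [LieRing.of_associative_ring_bracket] at this ⊢
  rw [← neg_eq_zero, ← this]
  noncomm_ring

end Ring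

theorem gt_glRel (hL : IsGeneric L) : GlRel n (fun k => gtDiag L (k + 1))
    (fun k => gtRaise L (k + 1)) (fun k => gtLower L (k + 1)) where
  hh i j hi hj := by
    rw [LieRing.of_associative_ring_bracket]
    apply end_ext
    intro R
    simp only [LinearMap.sub_apply, LinearMap.zero_apply, Module.End.mul_apply, gtDiag_single,
      map_smul, smul_smul]
    rw [mul_comm, sub_self]
  he i k hi hk := brk_neg_right (b := stepOp L (k + 1) (k + 1 + 1) 1) (lie_diag_step _
      fun R j hj => (diagCoeff_move R 1 hk hj (i + 1)).trans (by simp))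
  hf i k hi hk := (LieRing.of_associative_ring_bracket _ _).trans (lie_diag_step _
      fun R j hj => (diagCoeff_move R (-1) hk hj (i + 1)).trans (by simp))
  ef k hk := by
    refine brk_neg_left (a := stepOp L (k + 1) (k + 1 + 1) 1)
      (c := gtDiag L (k + 1 + 1)) (d := gtDiag L (k + 1)) ?_
    apply end_ext
    intro R
    refine (lie_ef_single hL 1 hk (by omega) (by omega) R).trans ?_
    rw [lagrange_ef hL (by omega) hk, LinearMap.sub_apply, gtDiag_single, gtDiag_single,
      ← sub_smul]
  ef' k l hk hl hkl := by
    refine brk_neg_left_zero (a := stepOp L (k + 1) (k + 1 + 1) 1) ?_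
    by_cases h : l = k + 1
    · subst h
      exact lie_stepOp_opp 1 hk hl (by omega)
    · exact lie_stepOp_far _ _ hk hl (by omega) (by omega) (by omega)
  ee k l hl hk := brk_neg_neg (a := stepOp L (k + 1) (k + 1 + 1) 1)
    (b := stepOp L (l + 1) (l + 1 + 1) 1)
    (lie_stepOp_far _ _ (by omega) hl (by omega) (by omega) (by omega))
  ff k l hl hk := (LieRing.of_associative_ring_bracket _ _).trans
    (lie_stepOp_far _ _ (by omega) hl (by omega) (by omega) (by omega))
  se k hk := brk_serre_neg (a := stepOp L (k + 1) (k + 2) 1) (b := stepOp L (k + 2) (k + 3) 1)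
    (serre_one hL 1 (by omega) hk (by omega) (by omega))
  se' k hk := brk_serre_neg (a := stepOp L (k + 2) (k + 3) 1) (b := stepOp L (k + 1) (k + 2) 1)
    (serre_two hL 1 hk (by omega) (by omega) (by omega) (by omega))
  sf k hk := brk_serre (a := stepOp L (k + 1) k (-1)) (b := stepOp L (k + 2) (k + 1) (-1))
    (serre_two hL (-1) (by omega) hk (by omega) (by omega) (by omega))
  sf' k hk := brk_serre (a := stepOp L (k + 2) (k + 1) (-1)) (b := stepOp L (k + 1) k (-1))
    (serre_one hL (-1) hk (by omega) (by omega) (by omega))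

end Verification

/-! ### The module `V(T(L))` of a generic tableau -/

noncomputable section GTModule

/-- The Lie algebra `gl(n)` of complex `n × n` matrices, with the commutator bracket. -/
abbrev gl (n : ℕ) := Matrix (Fin n) (Fin n) ℂ

variable {n : ℕ} {L : Tableau n}

/-- The representation of `gl(n)` given by the Gelfand--Tsetlin formulas. -/
def gtRep (hL : IsGeneric L) : gl n →ₗ⁅ℂ⁆ Module.End ℂ (lattice L →₀ ℂ) := glHom (gt_glRel hL)

/-- The vector space `V(T(L))` with basis `B(T(L))`, for a generic tableau `T(L)`. -/
def GTModule (L : Tableau n) (_hL : IsGeneric L) : Type := lattice L →₀ ℂ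

instance instAddCommGroupGTModule (hL : IsGeneric L) : AddCommGroup (GTModule L hL) :=
  inferInstanceAs (AddCommGroup (lattice L →₀ ℂ))

instance instModuleGTModule (hL : IsGeneric L) : Module ℂ (GTModule L hL) :=
  inferInstanceAs (Module ℂ (lattice L →₀ ℂ))

instance instLieRingModuleGTModule (hL : IsGeneric L) : LieRingModule (gl n) (GTModule L hL) where
  bracket x v := gtRep hL x v
  add_lie x y v := by
    change gtRep hL (x + y) v = gtRep hL x v + gtRep hL y v
    rw [map_add]; rfl
  lie_add x v w := LinearMap.map_add (gtRep hL x) v w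
  leibniz_lie x y v := by
    change gtRep hL x (gtRep hL y v) = gtRep hL ⁅x, y⁆ v + gtRep hL y (gtRep hL x v)
    rw [LieHom.map_lie]
    exact (sub_add_cancel _ _).symm

instance instLieModuleGTModule (hL : IsGeneric L) : LieModule ℂ (gl n) (GTModule L hL) where
  smul_lie c x v := by
    change gtRep hL (c • x) v = c • gtRep hL x v
    rw [map_smul]; rfl
  lie_smul c x v := LinearMap.map_smul (gtRep hL x) c v

/-- The tableau `T(R)` in `B(T(L))` as a vector of `V(T(L))`. -/
def tab (hL : IsGeneric L) (R : lattice L) : GTModule L hL := Finsupp.single R (1 : ℂ)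

/-- `U · T(R)`: the `gl(n)`-submodule of `V(T(L))` generated by `T(R)`. -/
def cyclic (hL : IsGeneric L) (R : lattice L) : LieSubmodule ℂ (gl n) (GTModule L hL) :=
  LieSubmodule.lieSpan ℂ (gl n) {tab hL R}

/-- The Gelfand--Tsetlin formula for `E_{k,k+1}`. -/
theorem raise_tab (hL : IsGeneric L) (R : lattice L) {k : ℕ} (hk1 : 1 ≤ k) (hk : k < n) :
    ⁅(Matrix.single ⟨k - 1, by omega⟩ ⟨k, hk⟩ 1 : gl n), tab hL R⁆ =
      -∑ i ∈ Icc 1 k, ((∏ j ∈ Icc 1 (k + 1), (entry R.1 k i - entry R.1 (k + 1) j)) /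
        ∏ j ∈ (Icc 1 k).erase i, (entry R.1 k i - entry R.1 k j)) • tab hL (move R k i 1) := by
  obtain ⟨k, rfl⟩ : ∃ m, k = m + 1 := ⟨k - 1, by omega⟩
  refine (LinearMap.congr_fun ((glHom_single (gt_glRel hL) _ _).trans
    (glE_up _ _ _ k)) (Finsupp.single R 1)).trans ?_
  rw [gtRaise, LinearMap.neg_apply, stepOp_single]
  rfl

/-- The Gelfand--Tsetlin formula for `E_{k+1,k}`. -/
theorem lower_tab (hL : IsGeneric L) (R : lattice L) {k : ℕ} (hk1 : 1 ≤ k) (hk : k < n) :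
    ⁅(Matrix.single ⟨k, hk⟩ ⟨k - 1, by omega⟩ 1 : gl n), tab hL R⁆ =
      ∑ i ∈ Icc 1 k, ((∏ j ∈ Icc 1 (k - 1), (entry R.1 k i - entry R.1 (k - 1) j)) /
        ∏ j ∈ (Icc 1 k).erase i, (entry R.1 k i - entry R.1 k j)) • tab hL (move R k i (-1)) := by
  obtain ⟨k, rfl⟩ : ∃ m, k = m + 1 := ⟨k - 1, by omega⟩
  refine (LinearMap.congr_fun ((glHom_single (gt_glRel hL) _ _).trans
    (glE_down _ _ _ k)) (Finsupp.single R 1)).trans ?_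
  rw [gtLower, stepOp_single]
  rfl

/-- The Gelfand--Tsetlin formula for `E_{kk}`. -/
theorem diag_tab (hL : IsGeneric L) (R : lattice L) {k : ℕ} (hk1 : 1 ≤ k) (hk : k ≤ n) :
    ⁅(Matrix.single ⟨k - 1, by omega⟩ ⟨k - 1, by omega⟩ 1 : gl n), tab hL R⁆ =
      ((k : ℂ) - 1 + ∑ i ∈ Icc 1 k, entry R.1 k i - ∑ i ∈ Icc 1 (k - 1), entry R.1 (k - 1) i) •
        tab hL R := by
  obtain ⟨k, rfl⟩ : ∃ m, k = m + 1 := ⟨k - 1, by omega⟩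
  refine (LinearMap.congr_fun ((glHom_single (gt_glRel hL) _ _).trans
    (glE_self _ _ _ k)) (Finsupp.single R 1)).trans ?_
  rw [gtDiag_single]
  rfl

end GTModule

end GelfandTsetlin

/-! The inclusion of cyclic modules says that `tab hL R` lies in `cyclic hL Q`, so the question is
which tableaux can be reached from T(Q).

Necessity. By genericity, the coefficient of T(R + δ^{ki}) in E_{k,k+1} T(R) vanishes exactly when
r_{ki} equals an entry of row k+1, and that of T(R - δ^{ki}) in E_{k+1,k} T(R) exactly when r_{ki}
equals an entry of row k-1. These are the steps that would turn a difference 0 recorded in Ω⁺ into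
-1. Hence Ω⁺ only grows along steps with nonzero coefficient, and the tableaux whose Ω⁺ contains
Ω⁺(T(Q)) span a submodule (`omegaSubmodule`, `OmegaPlus_subset_of_tab_mem`).

Sufficiency needs two things. The first is to isolate a single tableau from the sum E_{k,k+1} T(Q)
or E_{k+1,k} T(Q). The terms are eigenvectors of the operator ∑ r_{ki}² of row k, with distinct
eigenvalues by genericity. This operator lies in the algebra generated by the Gelfand--Tsetlin
operators (`rowPow_two_mem`), by induction on the row: its commutator with E_{k,k+1} gives a
weighted raising operator, whose commutator with E_{k+1,k} is diagonal, and Lagrange interpolation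
expresses the eigenvalue through power sums of rows k-1, k, k+1. So every term with nonzero
coefficient lies in the submodule (`tab_move_mem`).

The second is a path. If Ω⁺(T(Q)) ⊆ Ω⁺(T(R)) and Q ≠ R, some entry of Q can be moved by one towards
R, with nonzero coefficient and with the new Ω⁺ still inside Ω⁺(T(R)) (`exists_raise`,
`exists_lower`). Induction on the ℓ¹ distance from Q to R finishes the proof
(`tab_mem_of_OmegaPlus_subset`). -/

namespace GelfandTsetlin

open Finset

/-! ### Lagrange interpolation in the next degree -/

section Interpolation

open Polynomial

/-- The third coefficient of `∏ (X - w_j)`, in terms of power sums. -/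
theorem two_mul_prod_X_sub_C_coeff {ι : Type*} [DecidableEq ι] (u : Finset ι) (w : ι → ℂ) (m : ℕ)
    (hm : #u = m + 2) :
    2 * (∏ j ∈ u, (X - C (w j))).coeff m = (∑ j ∈ u, w j) ^ 2 - ∑ j ∈ u, w j ^ 2 := by
  induction u using Finset.induction_on generalizing m with
  | empty => simp at hm
  | insert a u ha ih =>
    rw [card_insert_of_notMem ha] at hm
    rw [prod_insert ha, sum_insert ha, sum_insert ha, sub_mul, coeff_sub, coeff_C_mul]
    have hp : (∏ j ∈ u, (X - C (w j))).coeff m = -∑ j ∈ u, w j := by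
      rw [← prod_X_sub_C_coeff_card_pred u w (by omega)]
      congr 1
      omega
    rw [hp]
    -- For m = 0 the summand with the factor X has no constant term, and the one remaining linear
    -- factor is computed directly; otherwise X shifts the coefficient and the induction hypothesis
    -- applies.
    rcases m with _ | m
    · obtain ⟨b, rfl⟩ := card_eq_one.1 (show #u = 1 by omega)
      simp
      ring
    · rw [coeff_X_mul, mul_sub, ih m (by omega)]
      ring

/-- Let P and Q be the monic polynomials with roots w and v. Reducing XP modulo Q does not change
its values at the nodes v, and the sum is the coefficient of degree #t - 1 of the remainder. -/
theorem sum_mul_eval_div {ι κ : Type*} [DecidableEq ι] [DecidableEq κ] (t : Finset ι) (v : ι → ℂ)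
    (hv : Set.InjOn v t) (u : Finset κ) (w : κ → ℂ) (hu : #u = #t) (ht : 2 ≤ #t) :
    2 * ∑ i ∈ t, v i * (∏ j ∈ u, (X - C (w j))).eval (v i) / ∏ j ∈ t.erase i, (v i - v j) =
      (∑ i ∈ t, v i - ∑ j ∈ u, w j) ^ 2 + ∑ i ∈ t, v i ^ 2 - ∑ j ∈ u, w j ^ 2 := by
  set P : ℂ[X] := ∏ j ∈ u, (X - C (w j)) with hP
  set Q : ℂ[X] := ∏ i ∈ t, (X - C (v i)) with hQ
  have hPm : P.Monic := monic_prod_of_monic _ _ fun i _ => monic_X_sub_C _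
  have hQm : Q.Monic := monic_prod_of_monic _ _ fun i _ => monic_X_sub_C _
  have hPd : P.natDegree = #t := by
    rw [hP, natDegree_prod_of_monic _ _ fun i _ => monic_X_sub_C _]; simp [hu]
  have hQd : Q.natDegree = #t := by
    rw [hQ, natDegree_prod_of_monic _ _ fun i _ => monic_X_sub_C _]; simp
  obtain ⟨m, hm⟩ : ∃ m, #t = m + 2 := ⟨#t - 2, by omega⟩
  have hP1 : P.coeff (m + 1) = -∑ j ∈ u, w j := by
    rw [← prod_X_sub_C_coeff_card_pred u w (by omega), hu, hm]; rfl
  have hQ1 : Q.coeff (m + 1) = -∑ i ∈ t, v i := by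
    rw [← prod_X_sub_C_coeff_card_pred t v (by omega), hm]; rfl
  have hP2 := two_mul_prod_X_sub_C_coeff u w m (by omega)
  have hQ2 := two_mul_prod_X_sub_C_coeff t v m (by omega)
  rw [← hP] at hP2
  rw [← hQ] at hQ2
  have hPt : P.coeff (m + 2) = 1 := by rw [← hm, ← hPd]; exact hPm.coeff_natDegree
  have hQt : Q.coeff (m + 2) = 1 := by rw [← hm, ← hQd]; exact hQm.coeff_natDegree
  set c : ℂ := ∑ i ∈ t, v i - ∑ j ∈ u, w j with hc
  -- X + c is the quotient of XP by Q: the constant c cancels the coefficient of degree #t.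
  set S : ℂ[X] := X * P - (X + C c) * Q with hS
  have hlt : S.degree < #t := by
    rw [degree_lt_iff_coeff_zero]
    intro l hl
    obtain ⟨l, rfl⟩ : ∃ r, l = r + 1 := ⟨l - 1, by omega⟩
    rw [hS, coeff_sub, add_mul, coeff_add, coeff_X_mul, coeff_X_mul, coeff_C_mul]
    rcases (show l = m + 1 ∨ l = m + 2 ∨ m + 2 < l by omega) with rfl | rfl | h
    · rw [hP1, hQ1, hQt, hc]; ring
    · rw [hPt, hQt, coeff_eq_zero_of_natDegree_lt (by omega)]; ring
    · rw [coeff_eq_zero_of_natDegree_lt (by omega), coeff_eq_zero_of_natDegree_lt (by omega),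
        coeff_eq_zero_of_natDegree_lt (by omega)]; ring
  have key := Lagrange.coeff_eq_sum hv hlt
  have hcoef : 2 * S.coeff (#t - 1) = 2 * P.coeff m - 2 * Q.coeff m - 2 * c * Q.coeff (m + 1) := by
    rw [hm, show m + 2 - 1 = m + 1 by omega, hS, coeff_sub, add_mul, coeff_add, coeff_X_mul,
      coeff_X_mul, coeff_C_mul]
    ring
  have hsum : ∑ i ∈ t, v i * P.eval (v i) / ∏ j ∈ t.erase i, (v i - v j) = S.coeff (#t - 1) := by
    rw [key]
    refine sum_congr rfl fun i hi => ?_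
    have : Q.eval (v i) = 0 := by rw [hQ, eval_prod, prod_eq_zero hi (by simp)]
    rw [hS, eval_sub, eval_mul, eval_mul, this, mul_zero, sub_zero, eval_X]
  rw [hsum, hcoef, hP2, hQ2, hQ1, hc]
  ring

end Interpolation

noncomputable section

variable {n : ℕ} {L : Tableau n}

/-! ### Diagonal operators and the algebra generated by the Gelfand--Tsetlin operators -/

/-- The operator that multiplies each `T(R)` by `f R`. -/
def diagOp (L : Tableau n) : (lattice L → ℂ) →ₐ[ℂ] Module.End ℂ (lattice L →₀ ℂ) where
  toFun f := Finsupp.linearCombination ℂ fun R => f R • Finsupp.single R (1 : ℂ)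
  map_one' := end_ext fun R => by simp
  map_mul' f g := end_ext fun R => by simp [mul_comm]
  map_zero' := end_ext fun R => by simp
  map_add' f g := end_ext fun R => by simp
  commutes' c := end_ext fun R => by simp [Algebra.algebraMap_eq_smul_one]

theorem diagOp_single (f : lattice L → ℂ) (R : lattice L) :
    diagOp L f (Finsupp.single R 1) = f R • Finsupp.single R (1 : ℂ) := by
  simp [diagOp]

/-- The associative algebra generated by the actions of `E_{kk}`, `E_{k,k+1}`, `E_{k+1,k}`. -/
def gtAlgebra (L : Tableau n) : Subalgebra ℂ (Module.End ℂ (lattice L →₀ ℂ)) :=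
  Algebra.adjoin ℂ ({T | ∃ k, 1 ≤ k ∧ k ≤ n ∧ T = gtDiag L k} ∪
    {T | ∃ k, 1 ≤ k ∧ k < n ∧ (T = gtRaise L k ∨ T = gtLower L k)})

theorem gtDiag_mem {k : ℕ} (hk1 : 1 ≤ k) (hk : k ≤ n) : gtDiag L k ∈ gtAlgebra L :=
  Algebra.subset_adjoin (Or.inl ⟨k, hk1, hk, rfl⟩)

theorem gtRaise_mem {k : ℕ} (hk1 : 1 ≤ k) (hk : k < n) : gtRaise L k ∈ gtAlgebra L :=
  Algebra.subset_adjoin (Or.inr ⟨k, hk1, hk, Or.inl rfl⟩)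

theorem gtLower_mem {k : ℕ} (hk1 : 1 ≤ k) (hk : k < n) : gtLower L k ∈ gtAlgebra L :=
  Algebra.subset_adjoin (Or.inr ⟨k, hk1, hk, Or.inr rfl⟩)

theorem gtAlgebra_sub_mem {S T : Module.End ℂ (lattice L →₀ ℂ)} (hS : S ∈ gtAlgebra L)
    (hT : T ∈ gtAlgebra L) : S - T ∈ gtAlgebra L := by
  have h : S - T = S + (-1 : ℂ) • T := end_ext fun R => by
    rw [LinearMap.sub_apply, LinearMap.add_apply, LinearMap.smul_apply, neg_one_smul,
      sub_eq_add_neg]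
  rw [h]
  exact add_mem hS (Subalgebra.smul_mem _ hT _)

theorem stepOp_raise_mem {k : ℕ} (hk1 : 1 ≤ k) (hk : k < n) :
    stepOp L k (k + 1) 1 ∈ gtAlgebra L := by
  have h : stepOp L k (k + 1) 1 = (-1 : ℂ) • gtRaise L k := end_ext fun R => by
    rw [gtRaise, LinearMap.smul_apply, LinearMap.neg_apply, neg_one_smul, neg_neg]
  rw [h]
  exact Subalgebra.smul_mem _ (gtRaise_mem hk1 hk) _

/-- The power sum `∑ r_{ki} ^ d` of row `k`. -/
def rowPow (L : Tableau n) (d k : ℕ) (R : lattice L) : ℂ := ∑ i ∈ Icc 1 k, entry R.1 k i ^ d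

/-- The eigenvalue of E_{kk} is k - 1 plus the difference of the sums of rows k and k-1, so the row
sums are obtained by telescoping. -/
theorem rowPow_one_mem {k : ℕ} (hk : k ≤ n) : diagOp L (rowPow L 1 k) ∈ gtAlgebra L := by
  induction k with
  | zero =>
    have : rowPow L 1 0 = 0 := by funext R; simp [rowPow]
    rw [this, map_zero]
    exact zero_mem _
  | succ k ih =>
    have : rowPow L 1 (k + 1) = (fun R : lattice L => diagCoeff R.1 (k + 1)) -
        algebraMap ℂ (lattice L → ℂ) k + rowPow L 1 k := by
      funext R
      simp only [rowPow, diagCoeff, pow_one, Pi.add_apply, Pi.sub_apply, Pi.algebraMap_apply,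
        Algebra.algebraMap_self, RingHom.id_apply, add_tsub_cancel_right]
      push_cast
      ring
    rw [this, map_add, map_sub, AlgHom.commutes]
    exact add_mem (gtAlgebra_sub_mem (gtDiag_mem (by omega) hk) (Subalgebra.algebraMap_mem _ _))
      (ih (by omega))

/-! ### Second power sums of the rows as elements of the generated algebra -/

theorem rowPow_two_move (R : lattice L) {k i : ℕ} (s : ℤ) (hk : k < n) (hi : i ∈ Icc 1 k) :
    rowPow L 2 k (move R k i s) = rowPow L 2 k R + (2 * s * entry R.1 k i + s ^ 2) := by
  unfold rowPow
  rw [← add_sum_erase _ _ hi, ← add_sum_erase _ (fun j => entry R.1 k j ^ 2) hi,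
    entry_move_self R s hk hi]
  rw [sum_congr rfl fun j hj => by rw [entry_move_col R s hk hi k (ne_of_mem_erase hj)]]
  ring

/-- The operator `E_{k,k+1}`, up to sign, with coefficients weighted by `r_{ki}`. -/
def weightedRaise (L : Tableau n) (k : ℕ) : Module.End ℂ (lattice L →₀ ℂ) :=
  Finsupp.linearCombination ℂ fun R =>
    ∑ i ∈ Icc 1 k, (entry R.1 k i * stepCoeff R.1 k (k + 1) i) •
      Finsupp.single (move R k i 1) (1 : ℂ)

theorem weightedRaise_single (k : ℕ) (R : lattice L) :
    weightedRaise L k (Finsupp.single R 1) =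
      ∑ i ∈ Icc 1 k, (entry R.1 k i * stepCoeff R.1 k (k + 1) i) •
        Finsupp.single (move R k i 1) (1 : ℂ) := by
  simp [weightedRaise]

/-- Raising r_{ki} by one increases the sum of squares by 2 r_{ki} + 1; this is how the weights
r_{ki} enter. -/
theorem lie_rowPow_raise {k : ℕ} (hk : k < n) :
    diagOp L (rowPow L 2 k) * stepOp L k (k + 1) 1 - stepOp L k (k + 1) 1 * diagOp L (rowPow L 2 k)
      = (2 : ℂ) • weightedRaise L k + stepOp L k (k + 1) 1 := by
  apply end_ext
  intro R
  simp only [LinearMap.sub_apply, LinearMap.add_apply, LinearMap.smul_apply, Module.End.mul_apply,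
    stepOp_single, diagOp_single, weightedRaise_single, map_sum, map_smul, smul_sum, smul_smul]
  rw [← sum_sub_distrib, ← sum_add_distrib]
  refine sum_congr rfl fun i hi => ?_
  rw [rowPow_two_move R 1 hk hi, ← sub_smul, ← add_smul]
  congr 1
  push_cast
  ring

theorem weightedRaise_mem {k : ℕ} (hk1 : 1 ≤ k) (hk : k < n)
    (h : diagOp L (rowPow L 2 k) ∈ gtAlgebra L) : weightedRaise L k ∈ gtAlgebra L := by
  have hE := stepOp_raise_mem (L := L) hk1 hk
  have h1 := gtAlgebra_sub_mem (mul_mem h hE) (mul_mem hE h)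
  rw [lie_rowPow_raise hk] at h1
  have h : weightedRaise L k = (1 / 2 : ℂ) •
      ((2 : ℂ) • weightedRaise L k + stepOp L k (k + 1) 1 - stepOp L k (k + 1) 1) :=
    end_ext fun R => by
      rw [LinearMap.smul_apply, LinearMap.sub_apply, LinearMap.add_apply, LinearMap.smul_apply,
        add_sub_cancel_right, smul_smul]
      norm_num
  rw [h]
  exact Subalgebra.smul_mem _ (gtAlgebra_sub_mem h1 hE) _

/-- The commutator is diagonal because raising one entry and lowering a different one of the same
row cancel: the weight r_{ki} does not see the lowering of another entry. The factor r_{ki} - 1 is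
the weight after r_{ki} has been lowered. -/
theorem lie_lower_weightedRaise_single (hL : IsGeneric L) {k : ℕ} (hk1 : 1 ≤ k) (hk : k < n)
    (R : lattice L) :
    (gtLower L k * weightedRaise L k - weightedRaise L k * gtLower L k) (Finsupp.single R 1) =
    (∑ i ∈ Icc 1 k, (entry R.1 k i * (stepCoeff R.1 k (k + 1) i *
        stepCoeff (move R k i 1).1 k (k - 1) i) -
      (entry R.1 k i - 1) * (stepCoeff R.1 k (k - 1) i *
        stepCoeff (move R k i (-1)).1 k (k + 1) i))) • Finsupp.single R (1 : ℂ) := by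
  unfold gtLower
  simp only [LinearMap.sub_apply, Module.End.mul_apply, stepOp_single, weightedRaise_single,
    map_sum, map_smul, smul_sum, smul_smul]
  rw [sum_comm (s := Icc 1 k) (t := Icc 1 k), ← sum_sub_distrib, sum_smul]
  refine sum_congr rfl fun i hi => ?_
  rw [← sum_sub_distrib, sum_eq_single i]
  · rw [mem_Icc] at hi
    have h1 := move_cancel R (-1) hk hi.1 hi.2
    rw [neg_neg] at h1
    rw [h1, move_cancel R 1 hk hi.1 hi.2, ← sub_smul, entry_move_self R _ hk (mem_Icc.2 hi)]
    congr 1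
    push_cast
    ring
  · intro i' hi' hne
    have hm := hi
    have hm' := hi'
    rw [mem_Icc] at hm hm'
    rw [move_comm R (-1) 1 hk hm.1 hm.2 hk hm'.1 hm'.2, ← sub_smul]
    -- The two orders give the same coefficient; only the factors that involve both i and i' change,
    -- and they agree up to two signs.
    convert zero_smul ℂ _
    have hi1 : i' ∈ (Icc 1 k).erase i := mem_erase.2 ⟨hne, hi'⟩
    have hi2 : i ∈ (Icc 1 k).erase i' := mem_erase.2 ⟨hne.symm, hi⟩
    simp only [stepCoeff_eq]
    rw [entry_move_col R (-1) hk hi k hne, entry_move_col R _ hk hi' k hne.symm,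
      rowProd_move_row R (-1) hk hi (show k + 1 ≠ k by omega),
      rowProd_move_row R _ hk hi' (show k - 1 ≠ k by omega)]
    rw [rowProd_split _ k hi1 (entry R.1 k i), rowProd_split _ k hi2 (entry R.1 k i'),
      rowProd_split _ k hi1 (entry R.1 k i), rowProd_split _ k hi2 (entry R.1 k i'),
      entry_move_self R (-1) hk hi, entry_move_self R _ hk hi',
      rowProd_move_col R (-1) hk hi k (notMem_erase _ _),
      rowProd_move_col R _ hk hi' k (notMem_erase _ _)]
    have n1 := rowProd_ne_zero hL R hk hi (erase_subset i' ((Icc 1 k).erase i)) 0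
    have n2 := rowProd_ne_zero hL R hk hi' (erase_subset i ((Icc 1 k).erase i')) 0
    have n3 := rowProd_ne_zero hL R hk hi (singleton_subset_iff.2 hi1) 0
    have n4 := rowProd_ne_zero hL R hk hi (singleton_subset_iff.2 hi1) (-1)
    simp only [rowProd, prod_singleton, Int.cast_zero, add_zero] at n3 n4
    simp only [Int.cast_zero, add_zero] at n1 n2
    have n6 : entry R.1 k i' - entry R.1 k i ≠ 0 := by
      rw [← neg_sub]; exact neg_ne_zero.2 n3
    have n7 : entry R.1 k i' - (entry R.1 k i + -1) ≠ 0 := by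
      rw [← neg_sub]; exact neg_ne_zero.2 (by simpa using n4)
    have n8 : entry R.1 k i - (entry R.1 k i' + 1) ≠ 0 := by
      convert n4 using 1; push_cast; ring
    push_cast at *
    field_simp
    ring
  · intro h; exact absurd hi h

/-- Interpolation at the 2k nodes r_{ki} and r_{ki} - 1, for the monic polynomial of degree 2k with
roots r_{k+1,j} and r_{k-1,j} - 1. The node r_{ki} yields the term that raises first, the node
r_{ki} - 1 the term that lowers first. -/
theorem lagrange_weighted (hL : IsGeneric L) {k : ℕ} (hk1 : 1 ≤ k) (hk : k < n) (R : lattice L) :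
    2 * ∑ i ∈ Icc 1 k, (entry R.1 k i * (stepCoeff R.1 k (k + 1) i *
        stepCoeff (move R k i 1).1 k (k - 1) i) -
      (entry R.1 k i - 1) * (stepCoeff R.1 k (k - 1) i *
        stepCoeff (move R k i (-1)).1 k (k + 1) i)) =
    (2 * rowPow L 1 k R - k - rowPow L 1 (k + 1) R - rowPow L 1 (k - 1) R + (k - 1 : ℕ)) ^ 2
      + (2 * rowPow L 2 k R - 2 * rowPow L 1 k R + k)
      - (rowPow L 2 (k + 1) R + rowPow L 2 (k - 1) R - 2 * rowPow L 1 (k - 1) R + (k - 1 : ℕ)) := by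
  classical
  simp only [rowPow, pow_one]
  set x : ℕ → ℂ := entry R.1 k with hx
  set y : ℕ → ℂ := entry R.1 (k + 1) with hy
  set z : ℕ → ℂ := entry R.1 (k - 1) with hz
  let t := (Icc 1 k).disjSum (Icc 1 k)
  let v : ℕ ⊕ ℕ → ℂ := Sum.elim x fun i => x i - 1
  let u := (Icc 1 (k + 1)).disjSum (Icc 1 (k - 1))
  let w : ℕ ⊕ ℕ → ℂ := Sum.elim y fun i => z i - 1
  have hgen : ∀ i ∈ Icc 1 k, ∀ j ∈ Icc 1 k, i ≠ j → ∀ m : ℤ, x i - x j ≠ m := by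
    intro i hi j hj hij m
    rw [mem_Icc] at hi hj
    exact generic_of_mem hL R k i j hi.1 hi.2 hj.1 hj.2 hk hij m
  have hv : Set.InjOn v t := by
    rintro (i | i) hi (j | j) hj hij <;>
    simp only [t, mem_coe, inl_mem_disjSum, inr_mem_disjSum] at hi hj <;>
    simp only [v, Sum.elim_inl, Sum.elim_inr] at hij
    · by_contra h
      exact hgen i hi j hj (by simpa using h) 0 (by push_cast; linear_combination hij)
    · rcases eq_or_ne i j with rfl | h
      · exact absurd hij (by intro h; simpa using congrArg (fun w => x i - w) h)
      · exact absurd (by push_cast; linear_combination hij) (hgen i hi j hj h (-1))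
    · rcases eq_or_ne i j with rfl | h
      · exact absurd hij (by intro h; simpa using congrArg (fun w => x i - w) h)
      · exact absurd (by push_cast; linear_combination hij) (hgen i hi j hj h 1)
    · by_contra h
      exact hgen i hi j hj (by simpa using h) 0 (by push_cast; linear_combination hij)
  have hcard : #t = 2 * k := by simp [t]; ring
  have hcard' : #u = #t := by simp [t, u]; omega
  have main := sum_mul_eval_div t v hv u w hcard' (by omega)
  have e1 : ∀ i, t.erase (Sum.inl i) = ((Icc 1 k).erase i).disjSum (Icc 1 k) := by
    intro i; ext (j | j) <;> simp [t]
  have e2 : ∀ i, t.erase (Sum.inr i) = (Icc 1 k).disjSum ((Icc 1 k).erase i) := by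
    intro i; ext (j | j) <;> simp [t]
  have hv1 : ∑ i ∈ t, v i = 2 * ∑ i ∈ Icc 1 k, x i - k := by
    simp [t, v, sum_disjSum]; ring
  have hv2 : ∑ i ∈ t, v i ^ 2 = 2 * ∑ i ∈ Icc 1 k, x i ^ 2 - 2 * ∑ i ∈ Icc 1 k, x i + k := by
    simp [t, v, sum_disjSum, sub_sq, sum_add_distrib, ← mul_sum, ← sum_mul]; ring
  have hw1 : ∑ i ∈ u, w i =
      ∑ i ∈ Icc 1 (k + 1), y i + ∑ i ∈ Icc 1 (k - 1), z i - (k - 1 : ℕ) := by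
    simp [u, w, sum_disjSum]; ring
  have hw2 : ∑ i ∈ u, w i ^ 2 = ∑ i ∈ Icc 1 (k + 1), y i ^ 2 + ∑ i ∈ Icc 1 (k - 1), z i ^ 2
      - 2 * ∑ i ∈ Icc 1 (k - 1), z i + (k - 1 : ℕ) := by
    simp [u, w, sum_disjSum, sub_sq, sum_add_distrib, ← mul_sum, ← sum_mul]; ring
  rw [hv1, hv2, hw1, hw2] at main
  refine Eq.trans ?_ (main.trans (by ring))
  congr 1
  simp only [t]
  rw [sum_disjSum, ← sum_add_distrib]
  refine sum_congr rfl fun i hi => ?_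
  have hP : ∀ c, Polynomial.eval c (∏ j ∈ u, (Polynomial.X - Polynomial.C (w j))) =
      rowProd R.1 (k + 1) (Icc 1 (k + 1)) c * rowProd R.1 (k - 1) (Icc 1 (k - 1)) (c + 1) := by
    intro c
    rw [Polynomial.eval_prod, prod_disjSum]
    simp only [Polynomial.eval_sub, Polynomial.eval_X, Polynomial.eval_C, rowProd, w,
      Sum.elim_inl, Sum.elim_inr]
    congr 1
    refine prod_congr rfl fun j _ => ?_
    rw [hz]; ring
  have hD1 : ∏ j ∈ t.erase (Sum.inl i), (v (Sum.inl i) - v j) =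
      rowProd R.1 k ((Icc 1 k).erase i) (x i) * rowProd R.1 k ((Icc 1 k).erase i) (x i + 1) := by
    rw [e1, prod_disjSum]
    simp only [v, Sum.elim_inl, Sum.elim_inr]
    rw [← mul_prod_erase _ _ hi]
    simp only [rowProd, ← hx]
    rw [sub_sub_cancel, one_mul]
    congr 1
    exact prod_congr rfl fun j _ => by ring
  -- The minus sign is the factor (r_{ki} - 1) - r_{ki}; it produces the difference in the
  -- commutator.
  have hD2 : ∏ j ∈ t.erase (Sum.inr i), (v (Sum.inr i) - v j) =
      - rowProd R.1 k ((Icc 1 k).erase i) (x i + (-1 : ℤ)) *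
        rowProd R.1 k ((Icc 1 k).erase i) (x i) := by
    rw [e2, prod_disjSum]
    simp only [v, Sum.elim_inl, Sum.elim_inr]
    rw [← mul_prod_erase _ _ hi]
    simp only [rowProd, ← hx]
    rw [sub_right_comm, sub_self, zero_sub, neg_one_mul]
    congr 1
    · congr 1
      exact prod_congr rfl fun j _ => by push_cast; ring
    · exact prod_congr rfl fun j _ => by ring
  rw [hP, hP, hD1, hD2]
  simp only [v, Sum.elim_inl, Sum.elim_inr, stepCoeff_eq, entry_move_self R _ hk hi, ← hx]
  rw [rowProd_move_row R _ hk hi (show k + 1 ≠ k by omega),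
    rowProd_move_row R _ hk hi (show k - 1 ≠ k by omega),
    rowProd_move_col R _ hk hi k (notMem_erase _ _),
    rowProd_move_col R _ hk hi k (notMem_erase _ _), sub_add_cancel]
  have n1 := rowProd_ne_zero hL R hk hi (Finset.Subset.refl ((Icc 1 k).erase i)) 0
  have n2 := rowProd_ne_zero hL R hk hi (Finset.Subset.refl ((Icc 1 k).erase i)) 1
  have n3 := rowProd_ne_zero hL R hk hi (Finset.Subset.refl ((Icc 1 k).erase i)) (-1)
  simp only [← hx, Int.cast_zero, add_zero, Int.cast_one] at n1 n2
  rw [← hx] at n3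
  push_cast at *
  rw [← sub_eq_add_neg] at *
  field_simp
  ring

/-- The eigenvalue of the diagonal commutator for row k+1 contains the sum of squares of row k+2
linearly; all its other terms come from row sums and from the squares of rows k and k+1, which are
already available. -/
theorem rowPow_two_mem (hL : IsGeneric L) {k : ℕ} (hk : k ≤ n) :
    diagOp L (rowPow L 2 k) ∈ gtAlgebra L := by
  induction k using Nat.strong_induction_on with
  | _ k ih =>
  match k with
  | 0 =>
    have : rowPow L 2 0 = 0 := by funext R; simp [rowPow]
    rw [this, map_zero]
    exact zero_mem _
  | 1 =>
    have : rowPow L 2 1 = rowPow L 1 1 ^ 2 := by funext R; simp [rowPow]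
    rw [this, map_pow]
    exact pow_mem (rowPow_one_mem hk) 2
  | k + 2 =>
    set a := rowPow L 1 (k + 2)
    set b := rowPow L 1 (k + 1)
    set c := rowPow L 1 k
    set p := rowPow L 2 (k + 1)
    set q := rowPow L 2 k
    set ψ : lattice L → ℂ := fun R => ∑ i ∈ Icc 1 (k + 1), (entry R.1 (k + 1) i *
        (stepCoeff R.1 (k + 1) (k + 1 + 1) i *
          stepCoeff (move R (k + 1) i 1).1 (k + 1) (k + 1 - 1) i) -
      (entry R.1 (k + 1) i - 1) * (stepCoeff R.1 (k + 1) (k + 1 - 1) i *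
        stepCoeff (move R (k + 1) i (-1)).1 (k + 1) (k + 1 + 1) i)) with hψ
    have hp : diagOp L p ∈ gtAlgebra L := ih (k + 1) (by omega) (by omega)
    have hq : diagOp L q ∈ gtAlgebra L := ih k (by omega) (by omega)
    have ha : diagOp L a ∈ gtAlgebra L := rowPow_one_mem hk
    have hb : diagOp L b ∈ gtAlgebra L := rowPow_one_mem (by omega)
    have hc : diagOp L c ∈ gtAlgebra L := rowPow_one_mem (by omega)
    have hF := gtLower_mem (L := L) (k := k + 1) (by omega) (by omega)
    have hW := weightedRaise_mem (L := L) (k := k + 1) (by omega) (by omega) hp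
    have hψm : diagOp L ψ ∈ gtAlgebra L := by
      have h1 := gtAlgebra_sub_mem (mul_mem hF hW) (mul_mem hW hF)
      have h2 : diagOp L ψ = gtLower L (k + 1) * weightedRaise L (k + 1) -
          weightedRaise L (k + 1) * gtLower L (k + 1) := end_ext fun R => by
        rw [lie_lower_weightedRaise_single hL (by omega) (by omega), diagOp_single]
      rwa [h2]
    -- `lagrange_weighted` for row k+1, solved for the squares of row k+2; the constants -(k+1) + k
    -- and (k+1) - k become -1 and 1.
    have key : rowPow L 2 (k + 2) = ((2 : ℂ) • b - a - c - 1) ^ 2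
        + ((2 : ℂ) • p - (2 : ℂ) • b + (1 : lattice L → ℂ)) - q + (2 : ℂ) • c
        - (2 : ℂ) • ψ := by
      funext R
      have := lagrange_weighted hL (k := k + 1) (by omega) (by omega) R
      simp only [Pi.add_apply, Pi.sub_apply, Pi.smul_apply, Pi.pow_apply, Pi.one_apply,
        smul_eq_mul]
      change 2 * ψ R = _ at this
      rw [add_tsub_cancel_right] at this
      push_cast at this
      linear_combination this
    rw [key]
    simp only [map_add, map_sub, map_pow, map_smul, map_one]
    have h2 : ∀ {T}, T ∈ gtAlgebra L → (2 : ℂ) • T ∈ gtAlgebra L :=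
      fun hT => Subalgebra.smul_mem _ hT _
    exact gtAlgebra_sub_mem (add_mem (gtAlgebra_sub_mem (add_mem
      (pow_mem (gtAlgebra_sub_mem (gtAlgebra_sub_mem (gtAlgebra_sub_mem (h2 hb) ha) hc) (one_mem _)) 2)
      (add_mem (gtAlgebra_sub_mem (h2 hp) (h2 hb)) (one_mem _))) hq) (h2 hc)) (h2 hψm)

end

attribute [local instance] LieRing.ofAssociativeRing

noncomputable section

variable {n : ℕ} {L : Tableau n}

/-! ### Submodules and the algebra of Gelfand--Tsetlin operators -/

theorem gtRep_single_down (hL : IsGeneric L) {k : ℕ} (hk1 : 1 ≤ k) (hk : k < n) :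
    gtRep hL (Matrix.single ⟨k, hk⟩ ⟨k - 1, by omega⟩ 1) = gtLower L k := by
  obtain ⟨k, rfl⟩ : ∃ m, k = m + 1 := ⟨k - 1, by omega⟩
  exact (glHom_single (gt_glRel hL) _ _).trans (glE_down _ _ _ k)

theorem gtRep_single_up (hL : IsGeneric L) {k : ℕ} (hk1 : 1 ≤ k) (hk : k < n) :
    gtRep hL (Matrix.single ⟨k - 1, by omega⟩ ⟨k, hk⟩ 1) = gtRaise L k := by
  obtain ⟨k, rfl⟩ : ∃ m, k = m + 1 := ⟨k - 1, by omega⟩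
  exact (glHom_single (gt_glRel hL) _ _).trans (glE_up _ _ _ k)

theorem gtRep_single_self (hL : IsGeneric L) {k : ℕ} (hk1 : 1 ≤ k) (hk : k ≤ n) :
    gtRep hL (Matrix.single ⟨k - 1, by omega⟩ ⟨k - 1, by omega⟩ 1) = gtDiag L k := by
  obtain ⟨k, rfl⟩ : ∃ m, k = m + 1 := ⟨k - 1, by omega⟩
  exact (glHom_single (gt_glRel hL) _ _).trans (glE_self _ _ _ k)

/-- A subspace that is stable under the generators is stable under the algebra they generate. -/
theorem apply_mem_of_mem_gtAlgebra {M : Submodule ℂ (lattice L →₀ ℂ)}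
    (hd : ∀ k, 1 ≤ k → k ≤ n → ∀ v ∈ M, gtDiag L k v ∈ M)
    (hu : ∀ k, 1 ≤ k → k < n → ∀ v ∈ M, gtRaise L k v ∈ M)
    (hl : ∀ k, 1 ≤ k → k < n → ∀ v ∈ M, gtLower L k v ∈ M)
    {T : Module.End ℂ (lattice L →₀ ℂ)} (hT : T ∈ gtAlgebra L) :
    ∀ v ∈ M, T v ∈ M := by
  induction hT using Algebra.adjoin_induction with
  | mem T hT =>
    rcases hT with ⟨k, hk1, hk, rfl⟩ | ⟨k, hk1, hk, rfl | rfl⟩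
    · exact hd k hk1 hk
    · exact hu k hk1 hk
    · exact hl k hk1 hk
  | algebraMap c => exact fun v hv => M.smul_mem c hv
  | add S T _ _ hS hT => exact fun v hv => M.add_mem (hS v hv) (hT v hv)
  | mul S T _ _ hS hT => exact fun v hv => hS _ (hT v hv)

/-- This lets operators such as `diagOp L (rowPow L 2 k)`, which need not come from elements of
gl(n), act on Lie submodules. -/
theorem lieSubmodule_gtAlgebra_mem (hL : IsGeneric L) (N : LieSubmodule ℂ (gl n) (GTModule L hL))
    {T : Module.End ℂ (lattice L →₀ ℂ)} (hT : T ∈ gtAlgebra L) {v : lattice L →₀ ℂ}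
    (hv : (v : GTModule L hL) ∈ N) : (T v : GTModule L hL) ∈ N := by
  have hN : ∀ (x : gl n) (w : lattice L →₀ ℂ), (w : GTModule L hL) ∈ N →
      (gtRep hL x w : GTModule L hL) ∈ N := fun x w hw => N.lie_mem hw
  refine apply_mem_of_mem_gtAlgebra (M := (N.toSubmodule : Submodule ℂ (GTModule L hL)))
    ?_ ?_ ?_ hT v hv
  · intro k hk1 hk w hw
    rw [← gtRep_single_self hL hk1 hk]
    exact hN _ w hw
  · intro k hk1 hk w hw
    rw [← gtRep_single_up hL hk1 hk]
    exact hN _ w hw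
  · intro k hk1 hk w hw
    rw [← gtRep_single_down hL hk1 hk]
    exact hN _ w hw

/-- Every matrix unit acts by one of the generators or by an iterated commutator of them. Thus
stability under gl(n) has to be checked on generators only. -/
theorem gtRep_mem (hL : IsGeneric L) (x : gl n) : gtRep hL x ∈ gtAlgebra L := by
  have hup : ∀ i j, j < n → rootUp (fun k => gtRaise L (k + 1)) i j ∈ gtAlgebra L := by
    intro i j hj
    induction j with
    | zero => exact zero_mem _
    | succ j ih =>
      rw [rootUp]
      split_ifs with h
      · subst h; exact gtRaise_mem (by omega) hj
      · have h1 := ih (by omega)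
        have h2 := gtRaise_mem (L := L) (k := j + 1) (by omega) hj
        exact gtAlgebra_sub_mem (mul_mem h1 h2) (mul_mem h2 h1)
  have hdn : ∀ i j, j < n → rootDown (fun k => gtLower L (k + 1)) i j ∈ gtAlgebra L := by
    intro i j hj
    induction j with
    | zero => exact zero_mem _
    | succ j ih =>
      rw [rootDown]
      split_ifs with h
      · subst h; exact gtLower_mem (by omega) hj
      · have h1 := ih (by omega)
        have h2 := gtLower_mem (L := L) (k := j + 1) (by omega) hj
        exact gtAlgebra_sub_mem (mul_mem h2 h1) (mul_mem h1 h2)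
  have hs : ∀ i j : Fin n, gtRep hL (Matrix.single i j 1) ∈ gtAlgebra L := by
    intro i j
    have h := glHom_single (gt_glRel hL) i j
    have h' : gtRep hL (Matrix.single i j 1) = _ := h
    rw [h']
    unfold glE
    split_ifs
    · exact gtDiag_mem (by omega) (by omega)
    · exact hup _ _ j.2
    · exact hdn _ _ i.2
  rw [Matrix.matrix_eq_sum_single x, map_sum]
  refine sum_mem fun i _ => ?_
  rw [map_sum]
  refine sum_mem fun j _ => ?_
  rw [show Matrix.single i j (x i j) = x i j • (Matrix.single i j 1 : gl n) by simp, map_smul]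
  exact Subalgebra.smul_mem _ (hs i j) _

/-! ### Separation of tableaux -/

/-- If a stable subspace contains a sum of eigenvectors for distinct eigenvalues, then it contains
each of them. -/
theorem mem_of_sum_eigenvectors_mem {V ι : Type*} [AddCommGroup V] [Module ℂ V] [DecidableEq ι]
    (M : Submodule ℂ V) (T : V →ₗ[ℂ] V) (hT : ∀ v ∈ M, T v ∈ M) (t : Finset ι) (v : ι → V)
    (c : ι → ℂ) (hc : Set.InjOn c t) (hv : ∀ i ∈ t, T (v i) = c i • v i) (hs : ∑ i ∈ t, v i ∈ M) :
    ∀ i ∈ t, v i ∈ M := by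
  induction t using Finset.induction_on generalizing v with
  | empty => simp
  | insert a t ha ih =>
    -- T - c_a kills the a-th vector and scales the others by nonzero factors, so the induction
    -- hypothesis applies to the rest.
    have h1 : ∑ i ∈ t, (c i - c a) • v i ∈ M := by
      have := M.sub_mem (hT _ hs) (M.smul_mem (c a) hs)
      rw [map_sum, smul_sum, ← sum_sub_distrib, sum_insert ha, hv a (mem_insert_self a t),
        sub_self, zero_add] at this
      convert this using 1
      refine sum_congr rfl fun i hi => ?_
      rw [hv i (mem_insert_of_mem hi), sub_smul]
    have h2 := ih (fun i => (c i - c a) • v i)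
      (hc.mono (by simp)) (fun i hi => by
        rw [map_smul, hv i (mem_insert_of_mem hi), smul_comm]) h1
    have h3 : ∀ i ∈ t, v i ∈ M := by
      intro i hi
      have hne : c i - c a ≠ 0 := sub_ne_zero.2 fun h => by
        have := hc (by simp [hi]) (by simp) h
        exact ha (this ▸ hi)
      exact (M.smul_mem_iff hne).1 (h2 i hi)
    intro i hi
    rcases mem_insert.1 hi with rfl | hi
    · rw [sum_insert ha] at hs
      exact (M.add_mem_iff_left (M.sum_mem h3)).1 hs
    · exact h3 i hi

/-- The terms of the step operator applied to T(R) have different sums of squares in row k, so a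
submodule that contains their sum contains each of them. -/
theorem tab_move_mem (hL : IsGeneric L) (N : LieSubmodule ℂ (gl n) (GTModule L hL)) {k r : ℕ}
    {s : ℤ} (hs : s ≠ 0) (hk : k < n) (hT : stepOp L k r s ∈ gtAlgebra L) {R : lattice L}
    (hR : tab hL R ∈ N) {i : ℕ} (hi : i ∈ Icc 1 k) (hc : stepCoeff R.1 k r i ≠ 0) :
    tab hL (move R k i s) ∈ N := by
  have hsum := lieSubmodule_gtAlgebra_mem hL N hT hR
  rw [tab, stepOp_single] at hsum
  obtain ⟨M, hM⟩ : ∃ M : Submodule ℂ (lattice L →₀ ℂ),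
      ∀ v : lattice L →₀ ℂ, v ∈ M ↔ (v : GTModule L hL) ∈ N :=
    ⟨(N.toSubmodule : Submodule ℂ (GTModule L hL)), fun _ => Iff.rfl⟩
  have hD : ∀ v ∈ M, diagOp L (rowPow L 2 k) v ∈ M := fun v hv =>
    (hM _).2 (lieSubmodule_gtAlgebra_mem hL N (rowPow_two_mem hL hk.le) ((hM _).1 hv))
  have h := mem_of_sum_eigenvectors_mem M (diagOp L (rowPow L 2 k)) hD (Icc 1 k)
    (fun i => stepCoeff R.1 k r i • Finsupp.single (move R k i s) (1 : ℂ))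
    (fun i => rowPow L 2 k (move R k i s)) ?_ ?_ ((hM _).2 hsum) i hi
  · exact (hM _).1 ((M.smul_mem_iff hc).1 h)
  · intro a ha b hb hab
    by_contra hne
    rw [mem_coe] at ha hb
    simp only [rowPow_two_move R s hk ha, rowPow_two_move R s hk hb] at hab
    have hs' : (s : ℂ) ≠ 0 := by exact_mod_cast hs
    -- Two of the eigenvalues differ by 2s(r_{ka} - r_{kb}), which genericity keeps away from 0.
    have : (s : ℂ) * (entry R.1 k a - entry R.1 k b) = 0 := by linear_combination hab / 2
    rw [mem_Icc] at ha hb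
    refine generic_of_mem hL R k a b ha.1 ha.2 hb.1 hb.2 hk hne 0 ?_
    simpa [hs'] using this
  · intro j hj
    rw [map_smul, diagOp_single, smul_comm]

/-- Genericity makes the denominator nonzero, so only a factor of the numerator can vanish. -/
theorem stepCoeff_ne_zero (hL : IsGeneric L) (R : lattice L) {k r i : ℕ} (hk : k < n)
    (hi : i ∈ Icc 1 k) :
    stepCoeff R.1 k r i ≠ 0 ↔ ∀ j, 1 ≤ j → j ≤ r → entry R.1 k i ≠ entry R.1 r j := by
  have h := rowProd_ne_zero hL R hk hi (Finset.Subset.refl _) 0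
  rw [Int.cast_zero, add_zero] at h
  rw [stepCoeff_eq, Ne, div_eq_zero_iff, or_iff_left h]
  simp [rowProd, prod_eq_zero_iff, sub_eq_zero]

/-! ### The tableaux of a cyclic submodule -/

/-- Raising r_{ki} lowers only the differences r_{k+1,j} - r_{ki}, by one. One of them can leave Ω⁺
only if it was 0, and `hc` excludes that. -/
theorem OmegaPlus_subset_raise {R : lattice L} {k i : ℕ} (hk : k < n) (hi : i ∈ Icc 1 k)
    (hc : ∀ j, 1 ≤ j → j ≤ k + 1 → entry R.1 k i ≠ entry R.1 (k + 1) j) :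
    OmegaPlus R.1 ⊆ OmegaPlus (move R k i 1).1 := by
  rw [mem_Icc] at hi
  rintro ⟨p, s, u⟩ ⟨hp, hs, hu, m, hm⟩
  refine ⟨hp, hs, hu, ?_⟩
  simp only [entry_move R 1 hk hi.1 hi.2] at hp hs hu hm ⊢
  split_ifs with h1 h2 h2
  · omega
  · exact ⟨m + 1, by push_cast; linear_combination hm⟩
  · rcases m with _ | m
    · obtain ⟨h3, rfl⟩ := h2
      refine absurd ?_ (hc s hs.1 (by omega))
      rw [show k + 1 = p by omega]
      rw [h3] at hm
      push_cast at hm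
      linear_combination -hm
    · exact ⟨m, by push_cast at *; linear_combination hm⟩
  · exact ⟨m, by linear_combination hm⟩

/-- Here the differences that fall are r_{ki} - r_{k-1,j}, and `hc` excludes the value 0. -/
theorem OmegaPlus_subset_lower {R : lattice L} {k i : ℕ} (hk : k < n) (hi : i ∈ Icc 1 k)
    (hc : ∀ j, 1 ≤ j → j ≤ k - 1 → entry R.1 k i ≠ entry R.1 (k - 1) j) :
    OmegaPlus R.1 ⊆ OmegaPlus (move R k i (-1)).1 := by
  rw [mem_Icc] at hi
  rintro ⟨p, s, u⟩ ⟨hp, hs, hu, m, hm⟩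
  refine ⟨hp, hs, hu, ?_⟩
  simp only [entry_move R (-1) hk hi.1 hi.2] at hp hs hu hm ⊢
  split_ifs with h1 h2 h2
  · omega
  · rcases m with _ | m
    · obtain ⟨rfl, rfl⟩ := h1
      refine absurd ?_ (hc u hu.1 hu.2)
      push_cast at hm
      linear_combination hm
    · exact ⟨m, by push_cast at *; linear_combination hm⟩
  · exact ⟨m + 1, by push_cast; linear_combination hm⟩
  · exact ⟨m, by linear_combination hm⟩

theorem stepOp_mem_supported {S : Set (lattice L)} {k r : ℕ} {s : ℤ}
    (h : ∀ R ∈ S, ∀ i ∈ Icc 1 k, stepCoeff R.1 k r i ≠ 0 → move R k i s ∈ S) :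
    ∀ v ∈ Finsupp.supported ℂ ℂ S, stepOp L k r s v ∈ Finsupp.supported ℂ ℂ S := by
  intro v hv
  rw [stepOp, Finsupp.linearCombination_apply]
  refine Submodule.sum_mem _ fun R hR => Submodule.smul_mem _ _ (Submodule.sum_mem _ fun i hi => ?_)
  by_cases hc : stepCoeff R.1 k r i = 0
  · rw [hc, zero_smul]; exact zero_mem _
  · exact Submodule.smul_mem _ _ (Finsupp.single_mem_supported ℂ _
      (h R ((Finsupp.mem_supported ℂ v).1 hv hR) i hi hc))

/-- The submodule spanned by the tableaux `T(R)` with `Ω⁺(T(Q)) ⊆ Ω⁺(T(R))`. -/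
def omegaSubmodule (hL : IsGeneric L) (Q : lattice L) : LieSubmodule ℂ (gl n) (GTModule L hL) where
  toSubmodule := (Finsupp.supported ℂ ℂ {R : lattice L | OmegaPlus Q.1 ⊆ OmegaPlus R.1} :
    Submodule ℂ (lattice L →₀ ℂ))
  lie_mem := by
    intro x v hv
    refine apply_mem_of_mem_gtAlgebra ?_ ?_ ?_ (gtRep_mem hL x) v hv
    · intro k _ _ w hw
      rw [gtDiag, Finsupp.linearCombination_apply]
      exact Submodule.sum_mem _ fun R hR => Submodule.smul_mem _ _ (Submodule.smul_mem _ _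
        (Finsupp.single_mem_supported ℂ _ ((Finsupp.mem_supported ℂ w).1 hw hR)))
    · intro k _ hk w hw
      exact Submodule.neg_mem _ (stepOp_mem_supported (fun R hR i hi hc => hR.trans
        (OmegaPlus_subset_raise hk hi ((stepCoeff_ne_zero hL R hk hi).1 hc))) w hw)
    · intro k _ hk w hw
      exact stepOp_mem_supported (fun R hR i hi hc => hR.trans
        (OmegaPlus_subset_lower hk hi ((stepCoeff_ne_zero hL R hk hi).1 hc))) w hw

/-- `omegaSubmodule hL Q` contains T(Q), hence all of `cyclic hL Q`, and a basis vector lies in the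
span of a set of basis vectors only if it belongs to the set. -/
theorem OmegaPlus_subset_of_tab_mem (hL : IsGeneric L) {R Q : lattice L}
    (h : tab hL R ∈ cyclic hL Q) : OmegaPlus Q.1 ⊆ OmegaPlus R.1 := by
  have hle : cyclic hL Q ≤ omegaSubmodule hL Q := by
    rw [cyclic, LieSubmodule.lieSpan_le, Set.singleton_subset_iff]
    exact Finsupp.single_mem_supported ℂ (1 : ℂ)
      (show Q ∈ {R : lattice L | OmegaPlus Q.1 ⊆ OmegaPlus R.1} from fun _ h => h)
  have h1 : (Finsupp.single R 1 : lattice L →₀ ℂ) ∈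
    Finsupp.supported ℂ ℂ {R : lattice L | OmegaPlus Q.1 ⊆ OmegaPlus R.1} := hle h
  rw [Finsupp.mem_supported] at h1
  exact h1 (by simp)

end

section Paths

variable {n : ℕ} {L : Tableau n}

/-! ### Paths between tableaux -/

/-- `z` is the integral vector `R - Q`. -/
def IsShift (Q R : lattice L) (z : ℕ → ℕ → ℤ) : Prop :=
  (∀ k i, entry R.1 k i = entry Q.1 k i + z k i) ∧ ∀ k i, z k i ≠ 0 → k < n ∧ i ∈ Icc 1 k

theorem exists_isShift (Q R : lattice L) : ∃ z, IsShift Q R z := by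
  obtain ⟨a, ha, hQ⟩ := Q.2
  obtain ⟨b, hb, hR⟩ := R.2
  -- The shift is 0 outside the tableau, where `entry` is 0 too, and in the top row, where both
  -- lattice vectors vanish. A nonzero shift therefore certifies that its position is movable.
  refine ⟨fun k i => if h : 1 ≤ i ∧ i ≤ k ∧ k ≤ n then b ⟨(k, i), h⟩ - a ⟨(k, i), h⟩ else 0,
    fun k i => ?_, fun k i h => ?_⟩
  · unfold entry
    dsimp only
    split_ifs with h
    · rw [hR, hQ]; push_cast; ring
    · simp
  · dsimp only at h
    by_cases h1 : 1 ≤ i ∧ i ≤ k ∧ k ≤ n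
    · rw [dif_pos h1] at h
      refine ⟨lt_of_le_of_ne h1.2.2 fun hk => h ?_, mem_Icc.2 ⟨h1.1, h1.2.1⟩⟩
      rw [ha _ hk, hb _ hk, sub_zero]
    · rw [dif_neg h1] at h
      exact absurd rfl h

theorem IsShift.move {Q R : lattice L} {z : ℕ → ℕ → ℤ} (hz : IsShift Q R z) {k i : ℕ} {s : ℤ}
    (h0 : z k i ≠ 0) :
    IsShift (move Q k i s) R fun a b => z a b - if a = k ∧ b = i then s else 0 := by
  obtain ⟨hk, hi⟩ := hz.2 k i h0
  have hi' := mem_Icc.1 hi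
  refine ⟨fun a b => ?_, fun a b h => ?_⟩
  · rw [entry_move Q s hk hi'.1 hi'.2, hz.1]
    push_cast
    ring
  · dsimp only at h
    by_cases hab : a = k ∧ b = i
    · rw [hab.1, hab.2]; exact ⟨hk, hi⟩
    · rw [if_neg hab, sub_zero] at h
      exact hz.2 a b h

/-- An inequality of `Ω⁺(T(Q))` that persists in `T(R)` bounds the shifts. -/
theorem IsShift.le_of_entry_eq {Q R : lattice L} {z : ℕ → ℕ → ℤ} (hz : IsShift Q R z)
    (hQR : OmegaPlus Q.1 ⊆ OmegaPlus R.1) {k i j : ℕ} (hk1 : 1 ≤ k) (hk : k < n)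
    (hi : i ∈ Icc 1 k) (hj : j ∈ Icc 1 (k + 1)) (h : entry Q.1 k i = entry Q.1 (k + 1) j) :
    z k i ≤ z (k + 1) j := by
  rw [mem_Icc] at hi hj
  have h1 : (k + 1, j, i) ∈ OmegaPlus Q.1 :=
    ⟨⟨by simp; omega, hk⟩, hj, by simpa using hi, 0, by simp [h]⟩
  obtain ⟨-, -, -, m, hm⟩ := hQR h1
  simp only [add_tsub_cancel_right, hz.1, h] at hm
  have : ((z (k + 1) j - z k i : ℤ) : ℂ) = (m : ℤ) := by push_cast; linear_combination hm
  have := Int.cast_injective this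
  omega

/-! ### Steps towards T(R) that keep Ω⁺ inside Ω⁺(T(R)) -/

/-- The only new members of Ω⁺ come from differences q_{ki} - q_{k-1,u} = -1. In T(R) such a
difference is -1 + z_{ki} - z_{k-1,u}, and `hpos` and `hgain` make it nonnegative. -/
theorem OmegaPlus_move_raise_subset {Q R : lattice L} {z : ℕ → ℕ → ℤ} (hz : IsShift Q R z)
    (hQR : OmegaPlus Q.1 ⊆ OmegaPlus R.1) {k i : ℕ} (hpos : 0 < z k i)
    (hgain : ∀ u, entry Q.1 k i - entry Q.1 (k - 1) u = -1 → z (k - 1) u ≤ 0) :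
    OmegaPlus (move Q k i 1).1 ⊆ OmegaPlus R.1 := by
  obtain ⟨hk, hi⟩ := hz.2 k i hpos.ne'
  rw [mem_Icc] at hi
  rintro ⟨p, s, u⟩ ⟨hp, hs, hu, m, hm⟩
  simp only [entry_move Q 1 hk hi.1 hi.2] at hp hs hu hm
  split_ifs at hm with h1 h2 h2
  · omega
  · rcases m with _ | m
    · refine ⟨hp, hs, hu, ?_⟩
      obtain ⟨rfl, rfl⟩ := h1
      have h3 : entry Q.1 p s - entry Q.1 (p - 1) u = -1 := by
        push_cast at hm; linear_combination hm
      have h4 := hgain u h3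
      refine ⟨(z p s - z (p - 1) u - 1).toNat, ?_⟩
      have h5 : (((z p s - z (p - 1) u - 1).toNat : ℤ) : ℂ) = z p s - z (p - 1) u - 1 := by
        rw [Int.toNat_of_nonneg (by omega)]; push_cast; ring
      rw [Int.cast_natCast] at h5
      simp only [h5, hz.1]
      linear_combination h3
    · exact hQR ⟨hp, hs, hu, m, by push_cast at *; linear_combination hm⟩
  · exact hQR ⟨hp, hs, hu, m + 1, by push_cast at *; linear_combination hm⟩
  · exact hQR ⟨hp, hs, hu, m, by linear_combination hm⟩

/-- The only new members come from q_{k+1,s} - q_{ki} = -1, which becomes -1 + z_{k+1,s} - z_{ki} ≥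
0 in T(R). -/
theorem OmegaPlus_move_lower_subset {Q R : lattice L} {z : ℕ → ℕ → ℤ} (hz : IsShift Q R z)
    (hQR : OmegaPlus Q.1 ⊆ OmegaPlus R.1) {k i : ℕ} (hneg : z k i < 0)
    (hgain : ∀ s, entry Q.1 (k + 1) s - entry Q.1 k i = -1 → 0 ≤ z (k + 1) s) :
    OmegaPlus (move Q k i (-1)).1 ⊆ OmegaPlus R.1 := by
  obtain ⟨hk, hi⟩ := hz.2 k i hneg.ne
  rw [mem_Icc] at hi
  rintro ⟨p, s, u⟩ ⟨hp, hs, hu, m, hm⟩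
  simp only [entry_move Q (-1) hk hi.1 hi.2] at hp hs hu hm
  split_ifs at hm with h1 h2 h2
  · omega
  · exact hQR ⟨hp, hs, hu, m + 1, by push_cast at *; linear_combination hm⟩
  · rcases m with _ | m
    · refine ⟨hp, hs, hu, ?_⟩
      obtain ⟨h2, rfl⟩ := h2
      obtain rfl : p = k + 1 := by omega
      simp only [add_tsub_cancel_right] at hm ⊢
      have h3 : entry Q.1 (k + 1) s - entry Q.1 k u = -1 := by
        push_cast at hm; linear_combination hm
      have h4 := hgain s h3
      refine ⟨(z (k + 1) s - z k u - 1).toNat, ?_⟩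
      have h5 : (((z (k + 1) s - z k u - 1).toNat : ℤ) : ℂ) = z (k + 1) s - z k u - 1 := by
        rw [Int.toNat_of_nonneg (by omega)]; push_cast; ring
      rw [Int.cast_natCast] at h5
      simp only [h5, hz.1]
      linear_combination h3
    · exact hQR ⟨hp, hs, hu, m, by push_cast at *; linear_combination hm⟩
  · exact hQR ⟨hp, hs, hu, m, by linear_combination hm⟩

/-- If some entry of `T(Q)` has to be raised, then one of them can be raised by `E_{k,k+1}` without
adding anything to `Ω⁺` that is not in `Ω⁺(T(R))`. -/
theorem exists_raise (hL : IsGeneric L) {Q R : lattice L} {z : ℕ → ℕ → ℤ} (hz : IsShift Q R z)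
    (hQR : OmegaPlus Q.1 ⊆ OmegaPlus R.1) (hex : ∃ k i, 0 < z k i) :
    ∃ k i, 0 < z k i ∧
      (∀ u, entry Q.1 k i - entry Q.1 (k - 1) u = -1 → z (k - 1) u ≤ 0) ∧
      ∀ j, 1 ≤ j → j ≤ k + 1 → entry Q.1 k i ≠ entry Q.1 (k + 1) j := by
  -- In the least row index with a positive shift, the condition on row k-1 holds for all u.
  have start : ∃ k i, 0 < z k i ∧
      ∀ u, entry Q.1 k i - entry Q.1 (k - 1) u = -1 → z (k - 1) u ≤ 0 := by
    classical
    obtain ⟨i, hi⟩ := Nat.find_spec hex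
    refine ⟨_, i, hi, fun u _ => ?_⟩
    by_contra hu
    have hk := (mem_Icc.1 (hz.2 _ _ hi.ne').2)
    have := Nat.find_min' hex ⟨u, not_le.1 hu⟩
    omega
  -- If the step is blocked by q_{ki} = q_{k+1,j}, then z_{k+1,j} ≥ z_{ki} > 0 and (k+1, j) becomes
  -- the candidate. The climb must stop, since row n has no nonzero shift.
  have climb : ∀ d k i, n - k = d → 0 < z k i →
      (∀ u, entry Q.1 k i - entry Q.1 (k - 1) u = -1 → z (k - 1) u ≤ 0) →
      ∃ k i, 0 < z k i ∧
      (∀ u, entry Q.1 k i - entry Q.1 (k - 1) u = -1 → z (k - 1) u ≤ 0) ∧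
      ∀ j, 1 ≤ j → j ≤ k + 1 → entry Q.1 k i ≠ entry Q.1 (k + 1) j := by
    intro d
    induction d using Nat.strong_induction_on with
    | _ d ih =>
    intro k i hd hpos hgain
    obtain ⟨hk, hi⟩ := hz.2 k i hpos.ne'
    have hi' := mem_Icc.1 hi
    by_cases hb : ∀ j, 1 ≤ j → j ≤ k + 1 → entry Q.1 k i ≠ entry Q.1 (k + 1) j
    · exact ⟨k, i, hpos, hgain, hb⟩
    push Not at hb
    obtain ⟨j, hj1, hj2, hj⟩ := hb
    have hle := hz.le_of_entry_eq hQR (by omega) hk hi (mem_Icc.2 ⟨hj1, hj2⟩) hj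
    -- The condition on the row below is automatic for the new candidate: q_{k+1,j} = q_{ki}, and
    -- genericity forbids q_{ki} - q_{ku} = -1.
    refine ih (n - (k + 1)) (by omega) (k + 1) j rfl (by omega) fun u hu => ?_
    rw [add_tsub_cancel_right] at hu ⊢
    rw [← hj] at hu
    by_contra hpu
    have hu' := mem_Icc.1 (hz.2 k u (not_le.1 hpu).ne').2
    rcases eq_or_ne i u with rfl | hne
    · rw [sub_self] at hu
      norm_num at hu
    · exact generic_of_mem hL Q k i u hi'.1 hi'.2 hu'.1 hu'.2 hk hne (-1) (by simpa using hu)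
  obtain ⟨k, i, h1, h2⟩ := start
  exact climb _ k i rfl h1 h2

/-- If some entry of `T(Q)` has to be lowered, then one of them can be lowered by `E_{k+1,k}`
without adding anything to `Ω⁺` that is not in `Ω⁺(T(R))`. -/
theorem exists_lower (hL : IsGeneric L) {Q R : lattice L} {z : ℕ → ℕ → ℤ} (hz : IsShift Q R z)
    (hQR : OmegaPlus Q.1 ⊆ OmegaPlus R.1) (hex : ∃ k i, z k i < 0) :
    ∃ k i, z k i < 0 ∧
      (∀ s, entry Q.1 (k + 1) s - entry Q.1 k i = -1 → 0 ≤ z (k + 1) s) ∧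
      ∀ j, 1 ≤ j → j ≤ k - 1 → entry Q.1 k i ≠ entry Q.1 (k - 1) j := by
  have start : ∃ k i, z k i < 0 ∧
      ∀ s, entry Q.1 (k + 1) s - entry Q.1 k i = -1 → 0 ≤ z (k + 1) s := by
    classical
    -- Minimising n - k selects the greatest row index with a negative shift, so that no shift of
    -- row k+1 is negative.
    have hex' : ∃ d k i, n - k = d ∧ z k i < 0 :=
      let ⟨k, i, h⟩ := hex
      ⟨_, k, i, rfl, h⟩
    obtain ⟨k, i, hd, hi⟩ := Nat.find_spec hex'
    refine ⟨k, i, hi, fun s _ => ?_⟩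
    by_contra hs
    have hk := (hz.2 _ _ hi.ne).1
    have := Nat.find_min' hex' ⟨k + 1, s, rfl, not_le.1 hs⟩
    omega
  -- A step blocked by q_{ki} = q_{k-1,j} passes the negative shift on to (k-1, j), because
  -- z_{k-1,j} ≤ z_{ki}. The descent stops at row 1 at the latest, where nothing can block.
  -- Genericity again gives the condition for the new candidate.
  have descend : ∀ k i, z k i < 0 →
      (∀ s, entry Q.1 (k + 1) s - entry Q.1 k i = -1 → 0 ≤ z (k + 1) s) →
      ∃ k i, z k i < 0 ∧
      (∀ s, entry Q.1 (k + 1) s - entry Q.1 k i = -1 → 0 ≤ z (k + 1) s) ∧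
      ∀ j, 1 ≤ j → j ≤ k - 1 → entry Q.1 k i ≠ entry Q.1 (k - 1) j := by
    intro k
    induction k with
    | zero =>
      intro i hneg
      have := mem_Icc.1 (hz.2 0 i hneg.ne).2
      omega
    | succ k ih =>
      intro i hneg hgain
      obtain ⟨hk, hi⟩ := hz.2 _ i hneg.ne
      have hi' := mem_Icc.1 hi
      by_cases hb : ∀ j, 1 ≤ j → j ≤ k + 1 - 1 → entry Q.1 (k + 1) i ≠ entry Q.1 (k + 1 - 1) j
      · exact ⟨k + 1, i, hneg, hgain, hb⟩
      push Not at hb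
      obtain ⟨j, hj1, hj2, hj⟩ := hb
      rw [add_tsub_cancel_right] at hj hj2
      have hle := hz.le_of_entry_eq hQR (by omega) (by omega) (mem_Icc.2 ⟨hj1, hj2⟩) hi hj.symm
      refine ih j (by omega) fun s hs => ?_
      rw [← hj] at hs
      by_contra hps
      have hs' := mem_Icc.1 (hz.2 (k + 1) s (not_le.1 hps).ne).2
      rcases eq_or_ne s i with rfl | hne
      · rw [sub_self] at hs
        norm_num at hs
      · exact generic_of_mem hL Q (k + 1) s i hs'.1 hs'.2 hi'.1 hi'.2 hk hne (-1) (by simpa using hs)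
  obtain ⟨k, i, h1, h2⟩ := start
  exact descend k i h1 h2

/-! ### Generation of tableaux along paths -/

theorem sum_natAbs_move_lt {z : ℕ → ℕ → ℤ} {k i : ℕ} {s : ℤ} (hk : k < n) (hi : i ∈ Icc 1 k)
    (h : (z k i - s).natAbs < (z k i).natAbs) :
    ∑ p ∈ range n ×ˢ range n, (z p.1 p.2 - if p.1 = k ∧ p.2 = i then s else 0).natAbs <
      ∑ p ∈ range n ×ˢ range n, (z p.1 p.2).natAbs := by
  rw [mem_Icc] at hi
  -- The box `range n ×ˢ range n` contains every movable position, since 1 ≤ i ≤ k < n.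
  refine sum_lt_sum (fun p _ => ?_) ⟨(k, i), by simp; omega, by simpa using h⟩
  split_ifs with hp
  · rw [hp.1, hp.2]; exact h.le
  · simp

/-- Induction on the ℓ¹ norm of the shift from Q to R, with Q varying: each admissible step replaces
Q by a tableau of N that is closer to R and still satisfies the inclusion of Ω⁺. -/
theorem tab_mem_of_OmegaPlus_subset (hL : IsGeneric L) {R : lattice L} {Q : lattice L}
    {N : LieSubmodule ℂ (gl n) (GTModule L hL)} (hQR : OmegaPlus Q.1 ⊆ OmegaPlus R.1)
    (hQ : tab hL Q ∈ N) : tab hL R ∈ N := by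
  obtain ⟨z, hz⟩ := exists_isShift Q R
  obtain ⟨d, hd⟩ : ∃ d, ∑ p ∈ range n ×ˢ range n, (z p.1 p.2).natAbs = d := ⟨_, rfl⟩
  induction d using Nat.strong_induction_on generalizing Q z with
  | _ d ih =>
  by_cases hpos : ∃ k i, 0 < z k i
  · obtain ⟨k, i, h1, h2, h3⟩ := exists_raise hL hz hQR hpos
    obtain ⟨hk, hi⟩ := hz.2 k i h1.ne'
    have hi' := mem_Icc.1 hi
    have hmem := tab_move_mem hL N one_ne_zero hk (stepOp_raise_mem (by omega) hk) hQ hi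
      ((stepCoeff_ne_zero hL Q hk hi).2 h3)
    exact ih _ (hd ▸ sum_natAbs_move_lt hk hi (s := 1) (by omega))
      (OmegaPlus_move_raise_subset hz hQR h1 h2) hmem _ (hz.move h1.ne') rfl
  by_cases hneg : ∃ k i, z k i < 0
  · obtain ⟨k, i, h1, h2, h3⟩ := exists_lower hL hz hQR hneg
    obtain ⟨hk, hi⟩ := hz.2 k i h1.ne
    have hi' := mem_Icc.1 hi
    have hmem := tab_move_mem hL N (neg_ne_zero.2 one_ne_zero) hk
      (gtLower_mem (by omega) hk) hQ hi ((stepCoeff_ne_zero hL Q hk hi).2 h3)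
    exact ih _ (hd ▸ sum_natAbs_move_lt hk hi (s := -1) (by omega))
      (OmegaPlus_move_lower_subset hz hQR h1 h2) hmem _ (hz.move h1.ne) rfl
  push Not at hpos hneg
  have : R = Q := lattice_ext fun a b => by
    rw [hz.1, le_antisymm (hpos a b) (hneg a b), Int.cast_zero, add_zero]
  rwa [this]

theorem cyclic_le_cyclic_iff (hL : IsGeneric L) (R Q : lattice L) :
    cyclic hL R ≤ cyclic hL Q ↔ OmegaPlus Q.1 ⊆ OmegaPlus R.1 := by
  have h : cyclic hL R ≤ cyclic hL Q ↔ tab hL R ∈ cyclic hL Q := by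
    rw [cyclic, LieSubmodule.lieSpan_le, Set.singleton_subset_iff, SetLike.mem_coe]
  rw [h]
  exact ⟨OmegaPlus_subset_of_tab_mem hL, fun hQR => tab_mem_of_OmegaPlus_subset hL hQR
    (LieSubmodule.subset_lieSpan (Set.mem_singleton _))⟩

end Paths

end GelfandTsetlin

theorem mainTheorem5 (n : ℕ) (hn : 2 ≤ n) (L : GelfandTsetlin.Tableau n)
    (hL : GelfandTsetlin.IsGeneric L) (R Q : GelfandTsetlin.lattice L) :
    (GelfandTsetlin.cyclic hL R = GelfandTsetlin.cyclic hL Q ↔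
      GelfandTsetlin.OmegaPlus Q.1 = GelfandTsetlin.OmegaPlus R.1) ∧
    (GelfandTsetlin.cyclic hL R ≤ GelfandTsetlin.cyclic hL Q ↔
      GelfandTsetlin.OmegaPlus Q.1 ⊆ GelfandTsetlin.OmegaPlus R.1) := by
  refine ⟨?_, GelfandTsetlin.cyclic_le_cyclic_iff hL R Q⟩
  rw [le_antisymm_iff, Set.Subset.antisymm_iff, GelfandTsetlin.cyclic_le_cyclic_iff,
    GelfandTsetlin.cyclic_le_cyclic_iff]
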